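/- Let $T>0$ and let $h:[-1,1]\to\mathbb R$ be $C^1$ (the background charge). Let $(\rho,E)$ be a classical solution of the one-dimensional Poisson–Nernst–Planck system with initial density $\rho_0$ and no-flux boundary condition, that is, for all $t\in[0,T]$, $$\partial_t\rho=\partial_x(\partial_x\rho-\rho E),\qquad \partial_xE=\rho-h\qquad (x\in(-1,1)),$$ $$\rho(0,x)=\rho_0(x)\quad (x\in(-1,1)),\qquad E(t,x)=0,\quad (\partial_x\rho-\rho E)(t,x)\cdot n_x=0\quad (x=\pm1),$$ where $E(t,\cdot)$ is continuous on $[-1,1]$ and $n_x=\pm1$ is the outward normal. Assume $\rho\in\widehat C^{(1,2)}([0,T]\times[-1,1])$: on some open set containing $[0,T]\times[-1,1]$, the function $\rho$ is defined and $\rho,\partial_t\rho,\partial_x\rho,\partial_x^2\rho$ exist and are continuous. Let the activation function $\bar\sigma\in C^2(\mathbb R)$ be not a polynomial; equivalently, let the neurons $(t,x)\mapsto\bar\sigma(w_1t+w_2x+b)$ be of class $C^{(1,2)}$ and $\bar\sigma$ be non-polynomial. For functions $r,e$ of $(t,x)$ put $\mathcal P=\partial_xe-r+h$ and let $$Loss_{GE}=\int_0^T\!\!\int_{-1}^1\Big(|\partial_tr-\partial_{xx}r+\partial_x(re)|^2+|\mathcal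 P|^2+|\partial_t\mathcal P|^2+|\partial_x\mathcal P|^2\Big)\,dx\,dt,$$ $$Loss_{IC}=\int_{-1}^1|r(0,x)-\rho_0(x)|^2\,dx+\int_{-1}^1\Big|e(0,x)-\Big(\int_{-1}^x\rho_0(y)\,dy-\int_{-1}^xh(y)\,dy\Big)\Big|^2dx,$$ $$Loss_{BC}=\int_0^T\sum_{x=\pm1}\Big(|\partial_xr(t,x)|^2+|e(t,x)|^2+|\partial_te(t,x)|^2\Big)\,dt,$$ and $Loss^{pnp}_{Total}(r,e)=Loss_{GE}+Loss_{IC}+Loss_{BC}$. (In the normalization $h\equiv1$ one has $\mathcal P=\partial_xe-r+1$ and $\int_{-1}^xh=x+1$.) Then there are two sequences of networks with one hidden layer and activation $\bar\sigma$, with outputs $$\rho_j(t,x)=\sum_{i=1}^{m_j}c_{j,i}\,\bar\sigma(\langle w_{j,i},(t,x)\rangle+b_{j,i}),\qquad E_j(t,x)=\sum_{i=1}^{m'_j}c'_{j,i}\,\bar\sigma(\langle w'_{j,i},(t,x)\rangle+b'_{j,i}),$$ with $m_j,m_j'\in\mathbb N$, $c_{j,i},b_{j,i},c'_{j,i},b'_{j,i}\in\mathbb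 R$ and $w_{j,i},w'_{j,i}\in\mathbb R^2$, such that $$Loss^{pnp}_{Total}(\rho_j,E_j)\longrightarrow0\qquad\text{as }j\to\infty .$$ -/

import Mathlib

namespace PNP

/-- `∂_t u` for a function `u` of time and position. -/
noncomputable def dt (u : ℝ → ℝ → ℝ) (t x : ℝ) : ℝ := deriv (fun s => u s x) t

/-- `∂_x u` for a function `u` of time and position. -/
noncomputable def dx (u : ℝ → ℝ → ℝ) (t x : ℝ) : ℝ := deriv (fun y => u t y) x

/-- `u ∈ C^{(1,2)}(U)` for an open set `U` of the `(t,x)`-plane: the partial derivatives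
`∂_t u`, `∂_x u`, `∂_x² u` exist at every point of `U`, and they and `u` are continuous on `U`.
(Mixed derivatives are not required.) -/
structure IsC12On (u : ℝ → ℝ → ℝ) (U : Set (ℝ × ℝ)) : Prop where
  diff_t : ∀ p ∈ U, DifferentiableAt ℝ (fun s => u s p.2) p.1
  diff_x : ∀ p ∈ U, DifferentiableAt ℝ (fun y => u p.1 y) p.2
  diff_xx : ∀ p ∈ U, DifferentiableAt ℝ (fun y => dx u p.1 y) p.2
  cont : ContinuousOn (fun p : ℝ × ℝ => u p.1 p.2) U
  cont_t : ContinuousOn (fun p : ℝ × ℝ => dt u p.1 p.2) U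
  cont_x : ContinuousOn (fun p : ℝ × ℝ => dx u p.1 p.2) U
  cont_xx : ContinuousOn (fun p : ℝ × ℝ => dx (dx u) p.1 p.2) U

/-- `u ∈ Ĉ^{(1,2)}(K)`: `u` is of class `C^{(1,2)}` on some open set containing `K`. -/
def IsHatC12 (u : ℝ → ℝ → ℝ) (K : Set (ℝ × ℝ)) : Prop :=
  ∃ U : Set (ℝ × ℝ), IsOpen U ∧ K ⊆ U ∧ IsC12On u U

/-- `(ρ, E)` solves the Poisson-Nernst-Planck system on `[0,T] × (-1,1)` with background charge
`h`, initial density `ρ₀`, the Dirichlet condition for `E` and the no-flux condition for `ρ`. -/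
structure IsSolution (T : ℝ) (h ρ₀ : ℝ → ℝ) (ρ E : ℝ → ℝ → ℝ) : Prop where
  /-- `∂_t ρ = ∂_x (∂_x ρ - ρ E)` -/
  nernst_planck : ∀ t ∈ Set.Icc 0 T, ∀ x ∈ Set.Ioo (-1 : ℝ) 1,
    HasDerivAt (fun y => dx ρ t y - ρ t y * E t y) (dt ρ t x) x
  /-- `ρ(0,x) = ρ₀(x)` -/
  initial : ∀ x ∈ Set.Ioo (-1 : ℝ) 1, ρ 0 x = ρ₀ x
  /-- `∂_x E = ρ - h` -/
  poisson : ∀ t ∈ Set.Icc 0 T, ∀ x ∈ Set.Ioo (-1 : ℝ) 1,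
    HasDerivAt (fun y => E t y) (ρ t x - h x) x
  /-- `E(t,·)` attains its boundary values continuously. -/
  field_cont : ∀ t ∈ Set.Icc 0 T, ContinuousOn (fun y => E t y) (Set.Icc (-1) 1)
  /-- `E = 0` on the boundary (this contains `E(0,-1) = 0`). -/
  dirichlet : ∀ t ∈ Set.Icc 0 T, E t (-1) = 0 ∧ E t 1 = 0
  /-- `(∂_x ρ - ρ E) · n_x = 0` on the boundary, where the outward normal is `n_x = x`. -/
  no_flux : ∀ t ∈ Set.Icc 0 T, ∀ x ∈ ({-1, 1} : Set ℝ),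
    (dx ρ t x - ρ t x * E t x) * x = 0

/-- The parameters of a network with two inputs `(t,x)`, one hidden layer and one output. -/
structure Network where
  /-- number of hidden neurons -/
  m : ℕ
  /-- inner weights -/
  w : Fin m → ℝ × ℝ
  /-- biases -/
  b : Fin m → ℝ
  /-- outer weights -/
  c : Fin m → ℝ

/-- The output `∑ᵢ cᵢ σ(⟨wᵢ, (t,x)⟩ + bᵢ)` of a network with activation `σ`. -/
noncomputable def Network.output (N : Network) (σ : ℝ → ℝ) (t x : ℝ) : ℝ :=
  ∑ i, N.c i * σ ((N.w i).1 * t + (N.w i).2 * x + N.b i)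

/-- Squared `L²` norm over `(0,T) × (-1,1)`. -/
noncomputable def sqBulk (T : ℝ) (u : ℝ → ℝ → ℝ) : ℝ :=
  ∫ t in Set.Ioo 0 T, ∫ x in Set.Ioo (-1 : ℝ) 1, |u t x| ^ 2

/-- Squared `L²` norm over `(0,T) × {-1,1}`. -/
noncomputable def sqBdry (T : ℝ) (u : ℝ → ℝ → ℝ) : ℝ :=
  ∫ t in Set.Ioo 0 T, (|u t (-1)| ^ 2 + |u t 1| ^ 2)

/-- The residual `∂_t r - ∂_xx r + ∂_x (r e)` of the Nernst-Planck equation. -/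
noncomputable def resNP (r e : ℝ → ℝ → ℝ) (t x : ℝ) : ℝ :=
  dt r t x - dx (dx r) t x + dx (fun s y => r s y * e s y) t x

/-- The residual `∂_x e - r + h` of the Poisson equation. -/
noncomputable def resPoisson (h : ℝ → ℝ) (r e : ℝ → ℝ → ℝ) (t x : ℝ) : ℝ :=
  dx e t x - r t x + h x

noncomputable def lossGE1 (T : ℝ) (r e : ℝ → ℝ → ℝ) : ℝ := sqBulk T (resNP r e)

noncomputable def lossGE2 (T : ℝ) (h : ℝ → ℝ) (r e : ℝ → ℝ → ℝ) : ℝ :=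
  sqBulk T (resPoisson h r e) + sqBulk T (dt (resPoisson h r e))
    + sqBulk T (dx (resPoisson h r e))

noncomputable def lossGE (T : ℝ) (h : ℝ → ℝ) (r e : ℝ → ℝ → ℝ) : ℝ :=
  lossGE1 T r e + lossGE2 T h r e

noncomputable def lossIC1 (ρ₀ : ℝ → ℝ) (r : ℝ → ℝ → ℝ) : ℝ :=
  ∫ x in Set.Ioo (-1 : ℝ) 1, |r 0 x - ρ₀ x| ^ 2

noncomputable def lossIC2 (h ρ₀ : ℝ → ℝ) (e : ℝ → ℝ → ℝ) : ℝ :=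
  ∫ x in Set.Ioo (-1 : ℝ) 1, |e 0 x - ((∫ y in (-1)..x, ρ₀ y) - ∫ y in (-1)..x, h y)| ^ 2

noncomputable def lossIC (h ρ₀ : ℝ → ℝ) (r e : ℝ → ℝ → ℝ) : ℝ :=
  lossIC1 ρ₀ r + lossIC2 h ρ₀ e

noncomputable def lossBC1 (T : ℝ) (r : ℝ → ℝ → ℝ) : ℝ := sqBdry T (dx r)

noncomputable def lossBC2 (T : ℝ) (e : ℝ → ℝ → ℝ) : ℝ := sqBdry T e + sqBdry T (dt e)

noncomputable def lossBC (T : ℝ) (r e : ℝ → ℝ → ℝ) : ℝ := lossBC1 T r + lossBC2 T e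

/-- The total loss of a density `r` and a field `e`. -/
noncomputable def lossTotal (T : ℝ) (h ρ₀ : ℝ → ℝ) (r e : ℝ → ℝ → ℝ) : ℝ :=
  lossGE T h r e + lossIC h ρ₀ r e + lossBC T r e

end PNP

/-! The loss is a finite sum of integrals of squares over bounded sets, so it is enough to make
every residual uniformly `O(δ)` (`lossTotal_le`). The passage goes from the solution to polynomials,
and from polynomials to networks.

Solution to polynomials. The density `ρ` is approximated by a polynomial `p` together with `∂_t`,
`∂_x`, `∂_x²` (`exists_planePoly_near`): a compactly supported extension of `ρ` is convolved with a
polynomial that imitates a mollifier. No time regularity of `E` is assumed, so `E` is not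
approximated with its derivatives. Instead `h` is approximated in `C¹` by a polynomial `η`, and the
field is replaced by `q(t,x) = ∫_{-1}^x (p - η)`. Its Poisson residual is `h - η`, which is
`C¹`-small and independent of `t`, and `q` is close to `E` because both vanish at `-1` and have
close `x`-derivatives. The delicate term is `∂_t q` on the boundary: it is close to `∫_{-1}^x ∂_t
ρ`, which by the no-flux condition at `-1` equals the flux `∂_x ρ - ρ E` at `x`, and this vanishes
at `±1`.

Polynomials to networks (`exists_network_jet_near`). This is the classical density argument for
nonpolynomial activations, run on second order jets so that derivatives converge too. Mollifications
of `σ` are limits of networks and are smooth; where the `k`-th derivative of one of them is nonzero,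
Taylor expansion in a small inner weight isolates `z ^ k` (`powJet_mem_of_smooth`). Powers of linear
forms in `(t,x)` span all polynomials. The mixed derivative `∂_t ∂_x` has to be controlled as well,
since `∂_t` of the Poisson residual contains it. -/

namespace PNP

open Set Filter Topology MeasureTheory

/-! ### Locally uniform closure of spaces of functions. -/

section LocUnifClosure

variable {X Y : Type*} [TopologicalSpace X] [NormedAddCommGroup Y] [NormedSpace ℝ Y]

/-- The closure of a space of functions under locally uniform convergence. -/
def locUnifClosure (S : Submodule ℝ (X → Y)) : Submodule ℝ (X → Y) where
  carrier := {f | ∀ K : Set X, IsCompact K → ∀ ε > 0, ∃ g ∈ S, ∀ x ∈ K, ‖g x - f x‖ ≤ ε}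
  zero_mem' := fun K _ ε hε => ⟨0, S.zero_mem, fun x _ => by simpa using hε.le⟩
  add_mem' := by
    intro f₁ f₂ h₁ h₂ K hK ε hε
    obtain ⟨g₁, hg₁, e₁⟩ := h₁ K hK (ε / 2) (half_pos hε)
    obtain ⟨g₂, hg₂, e₂⟩ := h₂ K hK (ε / 2) (half_pos hε)
    refine ⟨g₁ + g₂, S.add_mem hg₁ hg₂, fun x hx => ?_⟩
    have : (g₁ + g₂) x - (f₁ + f₂) x = (g₁ x - f₁ x) + (g₂ x - f₂ x) := by
      simp only [Pi.add_apply]; abel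
    rw [this]
    exact (norm_add_le _ _).trans (by linarith [e₁ x hx, e₂ x hx])
  smul_mem' := by
    intro c f hf K hK ε hε
    have hc : 0 < |c| + 1 := by positivity
    obtain ⟨g, hg, e⟩ := hf K hK (ε / (|c| + 1)) (div_pos hε hc)
    refine ⟨c • g, S.smul_mem c hg, fun x hx => ?_⟩
    rw [Pi.smul_apply, Pi.smul_apply, ← smul_sub, norm_smul, Real.norm_eq_abs]
    calc |c| * ‖g x - f x‖ ≤ (|c| + 1) * (ε / (|c| + 1)) :=
          mul_le_mul (by linarith) (e x hx) (norm_nonneg _) hc.le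
      _ = ε := by field_simp

theorem le_locUnifClosure (S : Submodule ℝ (X → Y)) : S ≤ locUnifClosure S :=
  fun f hf K _ ε hε => ⟨f, hf, fun x _ => by simpa using hε.le⟩

/-- Lets an approximant be assembled from functions that are themselves only limits, as in the
induction over powers. -/
theorem locUnifClosure_idem (S : Submodule ℝ (X → Y)) :
    locUnifClosure (locUnifClosure S) = locUnifClosure S := by
  refine le_antisymm (fun f hf K hK ε hε => ?_) (le_locUnifClosure _)
  obtain ⟨g, hg, e⟩ := hf K hK (ε / 2) (half_pos hε)
  obtain ⟨g', hg', e'⟩ := hg K hK (ε / 2) (half_pos hε)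
  refine ⟨g', hg', fun x hx => ?_⟩
  have : g' x - f x = (g' x - g x) + (g x - f x) := by abel
  rw [this]
  exact (norm_add_le _ _).trans (by linarith [e x hx, e' x hx])

/-- Continuous maps send compact sets to compact sets, and a bounded operator enlarges errors by at
most its norm. This transports approximations along dilations of the line and from the line to ridge
functions in the plane. -/
theorem comp_mem_locUnifClosure {X' Y' : Type*} [TopologicalSpace X'] [NormedAddCommGroup Y']
    [NormedSpace ℝ Y'] {S : Submodule ℝ (X → Y)} {S' : Submodule ℝ (X' → Y')}
    {φ : X' → X} (hφ : Continuous φ) (L : Y →L[ℝ] Y')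
    (hS : ∀ g ∈ S, (fun x => L (g (φ x))) ∈ S') {f : X → Y} (hf : f ∈ locUnifClosure S) :
    (fun x => L (f (φ x))) ∈ locUnifClosure S' := by
  intro K hK ε hε
  have hc : 0 < ‖L‖ + 1 := by positivity
  obtain ⟨g, hg, e⟩ := hf (φ '' K) (hK.image hφ) (ε / (‖L‖ + 1)) (div_pos hε hc)
  refine ⟨_, hS g hg, fun x hx => ?_⟩
  rw [← map_sub]
  calc ‖L (g (φ x) - f (φ x))‖ ≤ ‖L‖ * ‖g (φ x) - f (φ x)‖ := L.le_opNorm _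
    _ ≤ (‖L‖ + 1) * (ε / (‖L‖ + 1)) :=
        mul_le_mul (by linarith) (e _ (mem_image_of_mem φ hx)) (norm_nonneg _) hc.le
    _ = ε := by field_simp

/-- A parametric integral is a locally uniform limit of its Riemann sums. -/
theorem intervalIntegral_mem_locUnifClosure {X : Type*} [PseudoMetricSpace X] [CompleteSpace Y]
    {S : Submodule ℝ (X → Y)} {G : X → ℝ → Y} (hG : Continuous (Function.uncurry G)) (hS : ∀ y, (fun z => G z y) ∈ S)
    {a b : ℝ} (hab : a < b) :
    (fun z => ∫ y in a..b, G z y) ∈ locUnifClosure S := by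
  intro K hK ε hε
  have hba : 0 < b - a := sub_pos.2 hab
  have hε' : 0 < ε / (b - a) := div_pos hε hba
  obtain ⟨δ, hδ, hmod⟩ : ∃ δ > 0, ∀ z ∈ K, ∀ y ∈ Icc a b, ∀ y' ∈ Icc a b, |y - y'| < δ →
      ‖G z y - G z y'‖ ≤ ε / (b - a) := by
    have huc := (hK.prod (isCompact_Icc (a := a) (b := b))).uniformContinuousOn_of_continuous
      hG.continuousOn
    obtain ⟨δ, hδ, h⟩ := Metric.uniformContinuousOn_iff.1 huc _ hε'
    refine ⟨δ, hδ, fun z hz y hy y' hy' hyy => ?_⟩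
    have := h (z, y) ⟨hz, hy⟩ (z, y') ⟨hz, hy'⟩ (by
      rw [Prod.dist_eq, dist_self, Real.dist_eq]; exact max_lt hδ hyy)
    rw [dist_eq_norm] at this
    exact this.le
  obtain ⟨n, hn⟩ := exists_nat_gt ((b - a) / δ)
  have hn0 : (0 : ℝ) < n := lt_trans (div_pos hba hδ) hn
  have hstep : (b - a) / n < δ := by
    rw [div_lt_iff₀ hδ] at hn; rw [div_lt_iff₀ hn0]; linarith
  set c : ℕ → ℝ := fun k => a + k * ((b - a) / n) with hc
  have hcs : ∀ k, c (k + 1) - c k = (b - a) / n := fun k => by simp only [hc]; push_cast; ring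
  have hc0 : c 0 = a := by simp [hc]
  have hcn : c n = b := by simp only [hc]; field_simp; ring
  have hmono : ∀ k, c k ≤ c (k + 1) := fun k => by
    have := hcs k; have : 0 < (b - a) / n := div_pos hba hn0; linarith
  have hcm : Monotone c := monotone_nat_of_le_succ hmono
  have hGz : ∀ z, Continuous (G z) := fun z => hG.comp (by fun_prop : Continuous fun y => (z, y))
  refine ⟨fun z => ∑ k ∈ Finset.range n, ((b - a) / n) • G z (c k), ?_, fun z hz => ?_⟩
  · have : (fun z => ∑ k ∈ Finset.range n, ((b - a) / n) • G z (c k))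
        = ∑ k ∈ Finset.range n, ((b - a) / n) • (fun z => G z (c k)) := by
      ext z; simp
    rw [this]
    exact S.sum_mem fun k _ => S.smul_mem _ (hS _)
  · have hsum : ∫ y in a..b, G z y = ∑ k ∈ Finset.range n, ∫ y in c k..c (k + 1), G z y := by
      rw [intervalIntegral.sum_integral_adjacent_intervals
        (fun k _ => (hGz z).intervalIntegrable _ _), hc0, hcn]
    simp only [hsum]
    rw [← Finset.sum_sub_distrib]
    calc _ ≤ ∑ k ∈ Finset.range n, ε / (b - a) * ((b - a) / n) := by
          refine norm_sum_le_of_le _ fun k hk => ?_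
          have hk' : k < n := Finset.mem_range.1 hk
          have hconst : ((b - a) / n) • G z (c k) = ∫ y in c k..c (k + 1), G z (c k) := by
            rw [intervalIntegral.integral_const, hcs]
          rw [hconst, ← intervalIntegral.integral_sub (by simp)
            ((hGz z).intervalIntegrable _ _)]
          have := intervalIntegral.norm_integral_le_of_norm_le_const
            (a := c k) (b := c (k + 1)) (f := fun y => G z (c k) - G z y) (C := ε / (b - a)) ?_
          · rwa [hcs, abs_of_pos (div_pos hba hn0)] at this
          · intro y hy
            rw [uIoc_of_le (hmono k)] at hy
            have hlo : a ≤ c k := hc0 ▸ hcm (Nat.zero_le k)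
            have hhi : c (k + 1) ≤ b := hcn ▸ hcm hk'
            refine hmod z hz _ ⟨hlo, (hmono k).trans hhi⟩ _ ⟨hlo.trans hy.1.le, hy.2.trans hhi⟩ ?_
            rw [abs_sub_comm, abs_of_pos (sub_pos.2 hy.1)]
            linarith [hcs k, hy.2]
      _ = ε := by
          rw [Finset.sum_const, Finset.card_range, nsmul_eq_mul]; field_simp

end LocUnifClosure


/-- Differentiation under an integral whose derivative is supported in a fixed compact set. -/
theorem hasDerivAt_integral_of_isCompact {X : Type*} [TopologicalSpace X] [T2Space X]
    [SecondCountableTopology X] [MeasurableSpace X] [BorelSpace X] (μ : Measure X)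
    [IsFiniteMeasureOnCompacts μ] {G G' : ℝ → X → ℝ} {K : Set X} (hK : IsCompact K) (s₀ : ℝ)
    (hG : ∀ s, Continuous (G s)) (hG' : Continuous (Function.uncurry G'))
    (hd : ∀ s u, HasDerivAt (fun s => G s u) (G' s u) s)
    (hsupp : ∀ s ∈ Metric.ball s₀ 1, ∀ u, u ∉ K → G' s u = 0) (hint : Integrable (G s₀) μ) :
    HasDerivAt (fun s => ∫ u, G s u ∂μ) (∫ u, G' s₀ u ∂μ) s₀ := by
  obtain ⟨M, hM⟩ := ((isCompact_closedBall s₀ 1).prod hK).exists_bound_of_continuousOn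
    hG'.continuousOn
  refine (hasDerivAt_integral_of_dominated_loc_of_deriv_le (μ := μ) (F := G) (F' := G')
    (bound := K.indicator fun _ => M) (Metric.ball_mem_nhds s₀ one_pos)
    (Eventually.of_forall fun s => (hG s).aestronglyMeasurable) hint
    (hG'.comp (by fun_prop : Continuous fun u => (s₀, u))).aestronglyMeasurable
    (Eventually.of_forall fun u s hs => ?_) ?_ (Eventually.of_forall fun u s _ => hd s u)).2
  · by_cases hu : u ∈ K
    · rw [indicator_of_mem hu]
      exact hM (s, u) ⟨Metric.ball_subset_closedBall hs, hu⟩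
    · rw [indicator_of_notMem hu, hsupp s hs u hu, norm_zero]
  · exact (integrable_indicator_iff hK.measurableSet).2
      (integrableOn_const hK.measure_lt_top.ne)

/-! ### Taylor remainders and limits of polynomials. -/

section Taylor

/-- The Taylor polynomial of `g` at `b` with `k` terms, as a function of the increment. -/
noncomputable def taylorSum (g : ℝ → ℝ) (b : ℝ) (k : ℕ) (u : ℝ) : ℝ :=
  ∑ m ∈ Finset.range k, iteratedDeriv m g b / m.factorial * u ^ m

theorem hasDerivAt_taylorSum (g : ℝ → ℝ) (b : ℝ) (k : ℕ) (u : ℝ) :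
    HasDerivAt (taylorSum g b (k + 1)) (taylorSum (deriv g) b k u) u := by
  have h : HasDerivAt (taylorSum g b (k + 1))
      (∑ m ∈ Finset.range (k + 1), iteratedDeriv m g b / m.factorial * (m * u ^ (m - 1))) u := by
    unfold taylorSum
    exact HasDerivAt.fun_sum fun m _ => (hasDerivAt_pow m u).const_mul _
  convert h using 1
  rw [Finset.sum_range_succ', taylorSum]
  simp only [Nat.cast_zero, zero_mul, mul_zero, add_zero, Nat.add_sub_cancel]
  refine Finset.sum_congr rfl fun m _ => ?_
  rw [iteratedDeriv_succ', Nat.factorial_succ]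
  push_cast
  field_simp

/-- The derivative of the remainder is the remainder of `deriv g` with one term fewer, so induction
and the mean value inequality apply. The factor `1 / k!` is given up, as only the order in `u`
matters. -/
theorem abs_sub_taylorSum_le (k : ℕ) {g : ℝ → ℝ} (hg : ContDiff ℝ (⊤ : ℕ∞) g) {b C r : ℝ}
    (hC : ∀ u, |u| ≤ r → |iteratedDeriv k g (b + u)| ≤ C) {u : ℝ} (hu : |u| ≤ r) :
    |g (b + u) - taylorSum g b k u| ≤ C * |u| ^ k := by
  induction k generalizing g u with
  | zero => simpa [taylorSum] using hC u hu
  | succ k ih =>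
    have hg' : ContDiff ℝ (⊤ : ℕ∞) (deriv g) := (contDiff_infty_iff_deriv.1 hg).2
    have hD : ∀ v, HasDerivAt (fun u => g (b + u) - taylorSum g b (k + 1) u)
        (deriv g (b + v) - taylorSum (deriv g) b k v) v := fun v => by
      refine HasDerivAt.sub ?_ (hasDerivAt_taylorSum g b k v)
      have := (hg.differentiable (by simp) (b + v)).hasDerivAt
      exact HasDerivAt.comp_const_add b v this
    have hb : ∀ v ∈ Metric.closedBall (0 : ℝ) |u|,
        ‖deriv g (b + v) - taylorSum (deriv g) b k v‖ ≤ C * |u| ^ k := fun v hv => by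
      have hv' : |v| ≤ |u| := by simpa using hv
      have h0 : 0 ≤ C := (abs_nonneg _).trans (hC v (hv'.trans hu))
      refine (ih hg' (fun w hw => ?_) (hv'.trans hu)).trans (by gcongr)
      rw [← iteratedDeriv_succ']
      exact hC w hw
    have := (convex_closedBall (0 : ℝ) |u|).norm_image_sub_le_of_norm_hasDerivWithin_le
      (fun v _ => (hD v).hasDerivWithinAt) hb (x := 0) (y := u) (by simp) (by simp)
    have h0 : g (b + 0) - taylorSum g b (k + 1) 0 = 0 := by
      rw [taylorSum, Finset.sum_range_succ']; simp
    rw [h0, sub_zero, sub_zero, Real.norm_eq_abs, Real.norm_eq_abs] at this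
    rw [pow_succ, ← mul_assoc]
    exact this

/-- A pointwise limit of polynomials of bounded degree is a polynomial. -/
theorem exists_polynomial_of_tendsto {k : ℕ} {p : ℕ → Polynomial ℝ} (hp : ∀ n, (p n).degree < k)
    {f : ℝ → ℝ} (hf : ∀ z, Tendsto (fun n => (p n).eval z) atTop (𝓝 (f z))) :
    ∃ q : Polynomial ℝ, ∀ z, f z = q.eval z := by
  have hinj : Set.InjOn (fun i : ℕ => (i : ℝ)) (Finset.range k) := Nat.cast_injective.injOn
  -- Interpolation at the `k` nodes `0, …, k - 1` reproduces each `p n` from finitely many of its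
  -- values, and these converge.
  refine ⟨Lagrange.interpolate (Finset.range k) (fun i : ℕ => (i : ℝ)) (fun i => f i), fun z => ?_⟩
  refine tendsto_nhds_unique (hf z) ?_
  have : ∀ n, (p n).eval z = ∑ i ∈ Finset.range k,
      (p n).eval (i : ℝ) * (Lagrange.basis (Finset.range k) (fun i : ℕ => (i : ℝ)) i).eval z := by
    intro n
    conv_lhs => rw [Lagrange.eq_interpolate (f := p n) hinj (by simpa using hp n)]
    simp [Lagrange.interpolate_apply, Polynomial.eval_finsetSum]
  simp only [this, Lagrange.interpolate_apply, Polynomial.eval_finsetSum, Polynomial.eval_mul,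
    Polynomial.eval_C]
  exact tendsto_finsetSum _ fun i _ => (hf i).mul_const _

end Taylor

/-! ### Powers as limits of one-dimensional networks. -/

section Jets

/-- The action on second order jets of the dilation by `w`. -/
noncomputable def dilation (w : ℝ) : (ℝ × ℝ × ℝ) →L[ℝ] (ℝ × ℝ × ℝ) :=
  (ContinuousLinearMap.id ℝ ℝ).prodMap
    ((w • ContinuousLinearMap.id ℝ ℝ).prodMap (w ^ 2 • ContinuousLinearMap.id ℝ ℝ))

theorem dilation_apply (w : ℝ) (y : ℝ × ℝ × ℝ) :
    dilation w y = (y.1, w * y.2.1, w ^ 2 * y.2.2) := rfl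

/-- If `F` is the second order jet of `f`, this is the jet of `z ↦ f (w * z + b)`. -/
noncomputable def dilateJet (F : ℝ → ℝ × ℝ × ℝ) (w b : ℝ) : ℝ → ℝ × ℝ × ℝ :=
  fun z => dilation w (F (w * z + b))

/-- The span of the jets of the neurons whose activation function has the jet `F`. -/
noncomputable def neuronSpan (F : ℝ → ℝ × ℝ × ℝ) : Submodule ℝ (ℝ → ℝ × ℝ × ℝ) :=
  Submodule.span ℝ (range fun p : ℝ × ℝ => dilateJet F p.1 p.2)

theorem dilateJet_mem_neuronSpan (F : ℝ → ℝ × ℝ × ℝ) (w b : ℝ) :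
    dilateJet F w b ∈ neuronSpan F := Submodule.subset_span ⟨(w, b), rfl⟩

/-- A dilated and translated neuron is again a neuron, so the span, and hence its closure, is
invariant under these operations. -/
theorem dilateJet_mem_locUnifClosure {F G : ℝ → ℝ × ℝ × ℝ}
    (hG : G ∈ locUnifClosure (neuronSpan F)) (w b : ℝ) :
    dilateJet G w b ∈ locUnifClosure (neuronSpan F) := by
  refine comp_mem_locUnifClosure (φ := fun z => w * z + b) (by fun_prop) (dilation w)
    (fun g hg => ?_) hG
  induction hg using Submodule.span_induction with
  | mem g hg =>
    obtain ⟨⟨w', b'⟩, rfl⟩ := hg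
    convert dilateJet_mem_neuronSpan F (w' * w) (w' * b + b') using 1
    ext z
    · simp only [dilateJet, dilation_apply]; ring_nf
    · simp only [dilateJet, dilation_apply]; ring_nf
    · simp only [dilateJet, dilation_apply]; ring_nf
  | zero => simp only [Pi.zero_apply, map_zero]; exact (neuronSpan F).zero_mem
  | add f g _ _ hf hg => simp only [Pi.add_apply, map_add]; exact (neuronSpan F).add_mem hf hg
  | smul c f _ hf => simp only [Pi.smul_apply, map_smul]; exact (neuronSpan F).smul_mem c hf

/-- The second order jet of `z ↦ z ^ k`. -/
noncomputable def powJet (k : ℕ) : ℝ → ℝ × ℝ × ℝ :=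
  fun z => (z ^ k, k * z ^ (k - 1), k * ((k - 1 : ℕ) * z ^ (k - 1 - 1)))

/-- Termwise differentiation turns Taylor sums of `τ` into shorter ones of its derivatives. The
length `j + 2` leaves room for two derivatives; the top power is `j + 1`. -/
theorem sum_smul_powJet (τ : ℝ → ℝ) (b s z : ℝ) (j : ℕ) :
    ∑ m ∈ Finset.range (j + 2), (iteratedDeriv m τ b / m.factorial * s ^ m) • powJet m z
      = dilation s (taylorSum τ b (j + 2) (s * z), taylorSum (deriv τ) b (j + 1) (s * z),
          taylorSum (deriv (deriv τ)) b j (s * z)) := by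
  rw [dilation_apply]
  refine Prod.ext ?_ (Prod.ext ?_ ?_)
  · rw [Prod.fst_sum]
    refine Finset.sum_congr rfl fun m _ => ?_
    simp only [powJet, Prod.smul_mk, smul_eq_mul]
    ring
  · change _ = s * taylorSum (deriv τ) b (j + 1) (s * z)
    rw [Prod.snd_sum, Prod.fst_sum, Finset.sum_range_succ', taylorSum, Finset.mul_sum]
    simp only [powJet, Prod.smul_mk, smul_eq_mul, Nat.cast_zero, zero_mul, mul_zero, add_zero]
    refine Finset.sum_congr rfl fun m _ => ?_
    rw [iteratedDeriv_succ', Nat.factorial_succ, Nat.add_sub_cancel]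
    push_cast
    field_simp
    ring
  · change _ = s ^ 2 * taylorSum (deriv (deriv τ)) b j (s * z)
    rw [Prod.snd_sum, Prod.snd_sum, Finset.sum_range_succ', Finset.sum_range_succ', taylorSum,
      Finset.mul_sum]
    simp only [powJet, Prod.smul_mk, smul_eq_mul, Nat.cast_zero, zero_mul, mul_zero, add_zero,
      Nat.zero_add, Nat.sub_self]
    refine Finset.sum_congr rfl fun m _ => ?_
    rw [iteratedDeriv_succ', iteratedDeriv_succ', Nat.factorial_succ, Nat.factorial_succ]
    simp only [Nat.add_sub_cancel]
    push_cast
    field_simp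
    ring

/-- To first nonvanishing order in `s`, after removal of the lower powers, `τ (s * z + b)` is a
nonzero multiple of `s ^ k * z ^ k`. Division by `s ^ k` leaves an error `O(s)` on compact sets, for
the derivatives in `z` as well. -/
theorem powJet_mem_of_smooth {S : Submodule ℝ (ℝ → ℝ × ℝ × ℝ)} {τ : ℝ → ℝ}
    (hτ : ContDiff ℝ (⊤ : ℕ∞) τ)
    (hS : ∀ w b, dilateJet (fun z => (τ z, deriv τ z, deriv (deriv τ) z)) w b ∈ locUnifClosure S)
    {k : ℕ} {b : ℝ} (hb : iteratedDeriv k τ b ≠ 0)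
    (hlt : ∀ m < k, powJet m ∈ locUnifClosure S) : powJet k ∈ locUnifClosure S := by
  set F : ℝ → ℝ × ℝ × ℝ := fun z => (τ z, deriv τ z, deriv (deriv τ) z) with hF
  set a : ℕ → ℝ := fun m => iteratedDeriv m τ b / m.factorial with ha
  have hak : a k ≠ 0 := div_ne_zero hb (by positivity)
  suffices h : a k • powJet k ∈ locUnifClosure S by
    simpa [smul_smul, hak] using (locUnifClosure S).smul_mem (a k)⁻¹ h
  cases k with
  | zero =>
    -- Inner weight zero gives the constant neuron `τ b`.
    convert hS 0 b using 1
    ext z <;> simp [powJet, dilateJet, dilation_apply, ha, hF]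
  | succ j =>
  have hτ1 : ContDiff ℝ (⊤ : ℕ∞) (deriv τ) := (contDiff_infty_iff_deriv.1 hτ).2
  have hτ2 : ContDiff ℝ (⊤ : ℕ∞) (deriv (deriv τ)) := (contDiff_infty_iff_deriv.1 hτ1).2
  obtain ⟨C, hC⟩ : ∃ C, ∀ u, |u| ≤ 1 → |iteratedDeriv (j + 2) τ (b + u)| ≤ C := by
    have hc : Continuous (fun u => iteratedDeriv (j + 2) τ (b + u)) :=
      (hτ.continuous_iteratedDeriv (j + 2) 
        (WithTop.coe_le_coe.2 le_top : (((j + 2 : ℕ) : ℕ∞) : WithTop ℕ∞) ≤ _)).comp (by fun_prop)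
    obtain ⟨C, hC⟩ := (isCompact_closedBall (0 : ℝ) 1).exists_bound_of_continuousOn hc.continuousOn
    exact ⟨C, fun u hu => hC u (by simpa using hu)⟩
  have hC0 : 0 ≤ C := (abs_nonneg _).trans (hC 0 (by simp))
  rw [← locUnifClosure_idem]
  intro K hK ε hε
  obtain ⟨R, hR⟩ := hK.exists_bound_of_continuousOn (f := fun z : ℝ => z) continuousOn_id
  set R' := max R 1 with hR'
  have hR1 : 1 ≤ R' := le_max_right _ _
  have hR0 : 0 < R' := by linarith
  -- The first bound keeps `s * z` in `[-1,1]`, where `C` is valid; the second makes the final error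
  -- `s * C * R' ^ (j + 2)` at most `ε`. The `+ 1` avoids a zero denominator.
  set s : ℝ := min (1 / R') (ε / (C * R' ^ (j + 2) + 1)) with hs
  have hs0 : 0 < s := lt_min (by positivity) (by positivity)
  have hsR : s * R' ≤ 1 := by
    have := min_le_left (1 / R') (ε / (C * R' ^ (j + 2) + 1))
    rw [← hs, le_div_iff₀ hR0] at this
    exact this
  have hs1 : s * (C * R' ^ (j + 2)) ≤ ε := by
    have := min_le_right (1 / R') (ε / (C * R' ^ (j + 2) + 1))
    rw [← hs, le_div_iff₀ (by positivity)] at this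
    nlinarith
  refine ⟨(s ^ (j + 1))⁻¹ • (dilateJet F s b
    - ∑ m ∈ Finset.range (j + 1), (a m * s ^ m) • powJet m), ?_, fun z hz => ?_⟩
  · refine Submodule.smul_mem _ _ (Submodule.sub_mem _ (hS s b) (Submodule.sum_mem _ fun m hm => ?_))
    exact Submodule.smul_mem _ _ (hlt m (Finset.mem_range.1 hm))
  · have hzR : |z| ≤ R' := (hR z hz).trans (le_max_left _ _)
    have hsz : |s * z| ≤ 1 := by
      rw [abs_mul, abs_of_pos hs0]
      exact (mul_le_mul_of_nonneg_left hzR hs0.le).trans hsR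
    -- The error is a triple of Taylor remainders of orders `j + 2`, `j + 1`, `j`; the factors `1,
    -- s, s ^ 2` of the dilation bring each of them to order `s ^ (j + 2)`.
    have key : ((s ^ (j + 1))⁻¹ • (dilateJet F s b
        - ∑ m ∈ Finset.range (j + 1), (a m * s ^ m) • powJet m)) z - (a (j + 1) • powJet (j + 1)) z
        = (s ^ (j + 1))⁻¹ • dilation s (τ (b + s * z) - taylorSum τ b (j + 2) (s * z),
          deriv τ (b + s * z) - taylorSum (deriv τ) b (j + 1) (s * z),
          deriv (deriv τ) (b + s * z) - taylorSum (deriv (deriv τ)) b j (s * z)) := by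
      have h1 : (a (j + 1) • powJet (j + 1)) z
          = (s ^ (j + 1))⁻¹ • ((a (j + 1) * s ^ (j + 1)) • powJet (j + 1) z) := by
        rw [smul_smul, Pi.smul_apply]; congr 1; field_simp
      rw [h1, Pi.smul_apply, ← smul_sub]
      congr 1
      rw [Pi.sub_apply, Finset.sum_apply, sub_sub]
      simp only [Pi.smul_apply]
      rw [← Finset.sum_range_succ (fun m => (a m * s ^ m) • powJet m z), sum_smul_powJet, dilateJet,
        ← map_sub]
      simp only [hF, Prod.mk_sub_mk, add_comm]
    rw [key, norm_smul, norm_inv, norm_pow, Real.norm_of_nonneg hs0.le,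
      inv_mul_le_iff₀ (by positivity), dilation_apply]
    have pw : ∀ i, i ≤ j + 2 → |z| ^ i ≤ R' ^ (j + 2) := fun i hi =>
      (pow_le_pow_left₀ (abs_nonneg z) hzR i).trans (pow_le_pow_right₀ hR1 hi)
    have e0 := abs_sub_taylorSum_le (j + 2) hτ hC hsz
    have e1 := abs_sub_taylorSum_le (j + 1) hτ1 (b := b) (C := C) (r := 1)
      (fun u hu => by rw [← iteratedDeriv_succ']; exact hC u hu) hsz
    have e2 := abs_sub_taylorSum_le j hτ2 (b := b) (C := C) (r := 1)
      (fun u hu => by rw [← iteratedDeriv_succ', ← iteratedDeriv_succ']; exact hC u hu) hsz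
    rw [abs_mul, abs_of_pos hs0, mul_pow] at e0 e1 e2
    have fin : ∀ i, i ≤ j + 2 → C * (s ^ (j + 2) * |z| ^ i) ≤ s ^ (j + 1) * ε := fun i hi =>
      calc C * (s ^ (j + 2) * |z| ^ i) ≤ C * (s ^ (j + 2) * R' ^ (j + 2)) := by
            gcongr; exact pw i hi
        _ = s ^ (j + 1) * (s * (C * R' ^ (j + 2))) := by ring
        _ ≤ _ := by gcongr
    rw [Prod.norm_mk, Prod.norm_mk, max_le_iff, max_le_iff]
    refine ⟨e0.trans (fin _ le_rfl), ?_, ?_⟩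
    · rw [norm_mul, Real.norm_of_nonneg hs0.le]
      refine (mul_le_mul_of_nonneg_left e1 hs0.le).trans (le_trans (le_of_eq ?_)
        (fin (j + 1) (by omega)))
      ring
    · rw [norm_mul, norm_pow, Real.norm_of_nonneg hs0.le]
      refine (mul_le_mul_of_nonneg_left e2 (sq_nonneg s)).trans (le_trans (le_of_eq ?_)
        (fin j (by omega)))
      ring

/-- A smooth function with vanishing `k`-th derivative is a polynomial of degree less than `k`. -/
theorem exists_polynomial_of_iteratedDeriv_eq_zero {k : ℕ} {τ : ℝ → ℝ}
    (hτ : ContDiff ℝ (⊤ : ℕ∞) τ) (h : ∀ b, iteratedDeriv k τ b = 0) :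
    ∃ p : Polynomial ℝ, p.degree < k ∧ ∀ z, τ z = p.eval z := by
  refine ⟨∑ m ∈ Finset.range k, Polynomial.C (iteratedDeriv m τ 0 / m.factorial) * Polynomial.X ^ m,
    ?_, fun z => ?_⟩
  · refine Polynomial.mem_degreeLT.1 (Submodule.sum_mem _ fun m hm => Polynomial.mem_degreeLT.2 ?_)
    exact lt_of_le_of_lt (Polynomial.degree_C_mul_X_pow_le _ _)
      (by exact_mod_cast Finset.mem_range.1 hm)
  · have := abs_sub_taylorSum_le k hτ (b := 0) (C := 0) (r := |z|) (fun u _ => by simp [h]) le_rfl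
    rw [zero_mul, zero_add] at this
    have h0 := sub_eq_zero.1 (abs_eq_zero.1 (le_antisymm this (abs_nonneg _)))
    rw [h0, taylorSum, Polynomial.eval_finsetSum]
    simp

theorem convolution_bump_eq_intervalIntegral (φ : ContDiffBump (0 : ℝ)) {Y : Type*}
    [NormedAddCommGroup Y] [NormedSpace ℝ Y] (f : ℝ → Y) (z : ℝ) :
    ∫ y in (-(φ.rOut + 1))..(φ.rOut + 1), φ.normed volume y • f (z - y)
      = ∫ y, φ.normed volume y • f (z - y) := by
  refine intervalIntegral.integral_eq_integral_of_support_subset fun y hy => ?_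
  have h1 : y ∈ Function.support (φ.normed volume) := fun h0 => hy (by simp [h0])
  rw [φ.support_normed_eq, mem_ball_zero_iff, Real.norm_eq_abs, abs_lt] at h1
  constructor <;> linarith [h1.1, h1.2]

/-- Riemann sums of the convolution are combinations of translates of `F`, that is, of neurons with
inner weight `1`. -/
theorem convolution_mem_locUnifClosure (φ : ContDiffBump (0 : ℝ)) {F : ℝ → ℝ × ℝ × ℝ}
    (hF : Continuous F) :
    (fun z => ∫ y, φ.normed volume y • F (z - y)) ∈ locUnifClosure (neuronSpan F) := by
  simp only [← convolution_bump_eq_intervalIntegral φ F]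
  refine intervalIntegral_mem_locUnifClosure (G := fun z y => φ.normed volume y • F (z - y))
    ?_ (fun y => ?_) (by linarith [φ.rOut_pos])
  · exact ((φ.continuous_normed).comp continuous_snd).smul
      (hF.comp (continuous_fst.sub continuous_snd))
  · convert Submodule.smul_mem _ (φ.normed volume y) (dilateJet_mem_neuronSpan F 1 (-y)) using 1
    ext z <;> simp [dilateJet, dilation_apply, sub_eq_add_neg]

/-- The derivative is placed on `f` rather than on the bump, so that the jet of a mollification is
the mollification of the jet. -/
theorem hasDerivAt_convolution_bump (φ : ContDiffBump (0 : ℝ)) {f f' : ℝ → ℝ}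
    (hf' : Continuous f') (h : ∀ z, HasDerivAt f (f' z) z) (z : ℝ) :
    HasDerivAt (fun z => ∫ y, φ.normed volume y • f (z - y))
      (∫ y, φ.normed volume y • f' (z - y)) z := by
  have hf : Continuous f := continuous_iff_continuousAt.2 fun z => (h z).continuousAt
  refine hasDerivAt_integral_of_isCompact volume (K := tsupport (φ.normed volume))
    (G := fun z y => φ.normed volume y • f (z - y))
    (G' := fun z y => φ.normed volume y • f' (z - y)) φ.hasCompactSupport_normed z
    (fun s => φ.continuous_normed.smul (hf.comp (by fun_prop)))
    ((φ.continuous_normed.comp continuous_snd).smul (hf'.comp (continuous_fst.sub continuous_snd)))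
    (fun s u => ?_) (fun s _ u hu => ?_) ?_
  · exact ((h (s - u)).comp_sub_const s u).const_mul _
  · simp [image_eq_zero_of_notMem_tsupport hu]
  · exact (φ.continuous_normed.smul (hf.comp (by fun_prop))).integrable_of_hasCompactSupport
      (φ.hasCompactSupport_normed.smul_right)

/-- The jets of all powers are locally uniform limits of jets of networks with a given
nonpolynomial `C²` activation function. -/
theorem powJet_mem_locUnifClosure {σ : ℝ → ℝ} (hσ : ContDiff ℝ 2 σ)
    (hpoly : ¬ ∃ p : Polynomial ℝ, ∀ z : ℝ, σ z = p.eval z) (k : ℕ) :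
    powJet k ∈ locUnifClosure (neuronSpan fun z => (σ z, deriv σ z, deriv (deriv σ) z)) := by
  have hσ' : ContDiff ℝ 1 (deriv σ) := ContDiff.deriv' (by simpa [one_add_one_eq_two] using hσ)
  have hσ'' : ContDiff ℝ 0 (deriv (deriv σ)) := ContDiff.deriv' (by simpa using hσ')
  have hd1 : ∀ z, HasDerivAt σ (deriv σ z) z := fun z =>
    (hσ.differentiable (by norm_num) z).hasDerivAt
  have hd2 : ∀ z, HasDerivAt (deriv σ) (deriv (deriv σ) z) z := fun z =>
    (hσ'.differentiable (by norm_num) z).hasDerivAt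
  set F : ℝ → ℝ × ℝ × ℝ := fun z => (σ z, deriv σ z, deriv (deriv σ) z) with hF
  have hFc : Continuous F := hσ.continuous.prodMk (hσ'.continuous.prodMk hσ''.continuous)
  let φ : ℕ → ContDiffBump (0 : ℝ) := fun n =>
    ⟨1 / (2 * (n + 1)), 1 / (n + 1), by positivity, by
      apply one_div_lt_one_div_of_lt <;> linarith [show (0 : ℝ) ≤ n from n.cast_nonneg]⟩
  let τ : ℕ → ℝ → ℝ := fun n z => ∫ y, (φ n).normed volume y • σ (z - y)
  have hτ : ∀ n, ContDiff ℝ (⊤ : ℕ∞) (τ n) := fun n =>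
    (φ n).hasCompactSupport_normed.contDiff_convolution_left (ContinuousLinearMap.lsmul ℝ ℝ)
      (φ n).contDiff_normed hσ.continuous.locallyIntegrable
  have hτσ : ∀ z, Tendsto (fun n => τ n z) atTop (𝓝 (σ z)) := fun z => by
    refine ContDiffBump.convolution_tendsto_right_of_continuous (μ := volume) (φ := φ) ?_
      hσ.continuous z
    exact tendsto_one_div_add_atTop_nhds_zero_nat
  have hτ1 : ∀ n, deriv (τ n) = fun z => ∫ y, (φ n).normed volume y • deriv σ (z - y) := fun n =>
    funext fun z => (hasDerivAt_convolution_bump (φ n) hσ'.continuous hd1 z).deriv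
  have hτ2 : ∀ n, deriv (deriv (τ n))
      = fun z => ∫ y, (φ n).normed volume y • deriv (deriv σ) (z - y) := fun n => by
    rw [hτ1]
    exact funext fun z => (hasDerivAt_convolution_bump (φ n) hσ''.continuous hd2 z).deriv
  have hjet : ∀ n, (fun z => (τ n z, deriv (τ n) z, deriv (deriv (τ n)) z))
      ∈ locUnifClosure (neuronSpan F) := fun n => by
    convert convolution_mem_locUnifClosure (φ n) hFc using 1
    funext z
    have hi : Integrable fun y => (φ n).normed volume y • F (z - y) :=
      ((φ n).continuous_normed.smul (hFc.comp (by fun_prop))).integrable_of_hasCompactSupport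
        ((φ n).hasCompactSupport_normed.smul_right)
    refine Prod.ext ?_ (Prod.ext ?_ ?_)
    · rw [fst_integral hi]; rfl
    · rw [snd_integral hi, fst_integral hi.snd, hτ1]; rfl
    · rw [snd_integral hi, snd_integral hi.snd, hτ2]; rfl
  induction k using Nat.strong_induction_on with
  | _ k ih =>
    -- Otherwise all mollifications are polynomials of degree below `k`, and so is their pointwise
    -- limit `σ`.
    obtain ⟨n, b, hb⟩ : ∃ n b, iteratedDeriv k (τ n) b ≠ 0 := by
      by_contra! hcon
      choose p hp hp' using fun n => exists_polynomial_of_iteratedDeriv_eq_zero (hτ n) (hcon n)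
      refine hpoly (exists_polynomial_of_tendsto hp fun z => ?_)
      simpa only [← hp'] using hτσ z
    exact powJet_mem_of_smooth (hτ n) (fun w b => dilateJet_mem_locUnifClosure (hjet n) w b) hb ih

end Jets

/-! ### From ridge functions to polynomials in the plane. -/

section PlaneJets

/-- The jets `(f, ∂_t f, ∂_x f, ∂_t ∂_x f, ∂_x² f)` of functions of `(t, x)`. -/
def planeJets : Submodule ℝ (ℝ × ℝ → Fin 5 → ℝ) where
  carrier := {J | ∀ t x, HasDerivAt (fun s => J (s, x) 0) (J (t, x) 1) t ∧
    HasDerivAt (fun y => J (t, y) 0) (J (t, x) 2) x ∧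
    HasDerivAt (fun s => J (s, x) 2) (J (t, x) 3) t ∧
    HasDerivAt (fun y => J (t, y) 2) (J (t, x) 4) x}
  zero_mem' := fun _ _ => ⟨hasDerivAt_const _ _, hasDerivAt_const _ _, hasDerivAt_const _ _,
    hasDerivAt_const _ _⟩
  add_mem' := fun h h' t x => ⟨(h t x).1.add (h' t x).1, (h t x).2.1.add (h' t x).2.1,
    (h t x).2.2.1.add (h' t x).2.2.1, (h t x).2.2.2.add (h' t x).2.2.2⟩
  smul_mem' := fun c _ h t x => ⟨(h t x).1.const_mul c, (h t x).2.1.const_mul c,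
    (h t x).2.2.1.const_mul c, (h t x).2.2.2.const_mul c⟩

variable {J : ℝ × ℝ → Fin 5 → ℝ} {f : ℝ → ℝ → ℝ}

theorem dt_eq_of_mem_planeJets (hJ : J ∈ planeJets) (h0 : ∀ t x, J (t, x) 0 = f t x) :
    dt f = fun t x => J (t, x) 1 := by
  funext t x
  simpa only [dt, ← h0] using (hJ t x).1.deriv

theorem dx_eq_of_mem_planeJets (hJ : J ∈ planeJets) (h0 : ∀ t x, J (t, x) 0 = f t x) :
    dx f = fun t x => J (t, x) 2 := by
  funext t x
  simpa only [dx, ← h0] using (hJ t x).2.1.deriv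

theorem dx_dx_eq_of_mem_planeJets (hJ : J ∈ planeJets) (h0 : ∀ t x, J (t, x) 0 = f t x) :
    dx (dx f) = fun t x => J (t, x) 4 := by
  funext t x
  rw [dx_eq_of_mem_planeJets hJ h0]
  exact (hJ t x).2.2.2.deriv

/-- The jet of the ridge function `f (α t + β x)` in terms of the jet of `f`. -/
noncomputable def ridge (α β : ℝ) : (ℝ × ℝ × ℝ) →L[ℝ] (Fin 5 → ℝ) :=
  LinearMap.toContinuousLinearMap
    { toFun := fun y => ![y.1, α * y.2.1, β * y.2.1, α * β * y.2.2, β ^ 2 * y.2.2]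
      map_add' := fun y y' => by
        ext i; fin_cases i <;> simp <;> ring
      map_smul' := fun c y => by
        ext i; fin_cases i <;> simp <;> ring }

theorem ridge_apply (α β : ℝ) (y : ℝ × ℝ × ℝ) :
    ridge α β y = ![y.1, α * y.2.1, β * y.2.1, α * β * y.2.2, β ^ 2 * y.2.2] := rfl

/-- The jet of the function `f (α t + β x + b)`, where `f` has the jet `F`. -/
noncomputable def ridgeJet (F : ℝ → ℝ × ℝ × ℝ) (α β b : ℝ) : ℝ × ℝ → Fin 5 → ℝ :=
  fun p => ridge α β (F (α * p.1 + β * p.2 + b))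

theorem ridgeJet_mem_planeJets {F : ℝ → ℝ × ℝ × ℝ}
    (h1 : ∀ z, HasDerivAt (fun z => (F z).1) (F z).2.1 z)
    (h2 : ∀ z, HasDerivAt (fun z => (F z).2.1) (F z).2.2 z) (α β b : ℝ) :
    ridgeJet F α β b ∈ planeJets := by
  intro t x
  have dT : HasDerivAt (fun s => α * s + β * x + b) α t := by
    simpa using (((hasDerivAt_id t).const_mul α).add_const (β * x)).add_const b
  have dX : HasDerivAt (fun y => α * t + β * y + b) β x := by
    simpa using (((hasDerivAt_id x).const_mul β).const_add (α * t)).add_const b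
  have e1 := (h1 (α * t + β * x + b)).comp t dT
  have e2 := (h1 (α * t + β * x + b)).comp x dX
  have e3 := ((h2 (α * t + β * x + b)).comp t dT).const_mul β
  have e4 := ((h2 (α * t + β * x + b)).comp x dX).const_mul β
  simp only [Function.comp_def] at e1 e2 e3 e4
  exact ⟨e1.congr_deriv (mul_comm _ _), e2.congr_deriv (mul_comm _ _),
    e3.congr_deriv (by change _ = α * β * _; ring), e4.congr_deriv (by change _ = β ^ 2 * _; ring)⟩

/-- The span of the jets of the neurons in the `(t, x)`-plane. -/
noncomputable def planeNeuronSpan (F : ℝ → ℝ × ℝ × ℝ) : Submodule ℝ (ℝ × ℝ → Fin 5 → ℝ) :=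
  Submodule.span ℝ (range fun p : (ℝ × ℝ) × ℝ => ridgeJet F p.1.1 p.1.2 p.2)

theorem ridgeJet_mem_locUnifClosure {F G : ℝ → ℝ × ℝ × ℝ}
    (hG : G ∈ locUnifClosure (neuronSpan F)) (α β : ℝ) :
    ridgeJet G α β 0 ∈ locUnifClosure (planeNeuronSpan F) := by
  refine comp_mem_locUnifClosure (φ := fun p : ℝ × ℝ => α * p.1 + β * p.2 + 0) (by fun_prop)
    (ridge α β) (fun g hg => ?_) hG
  induction hg using Submodule.span_induction with
  | mem g hg =>
    obtain ⟨⟨w, b⟩, rfl⟩ := hg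
    have h : ridgeJet F (w * α) (w * β) b ∈ planeNeuronSpan F :=
      Submodule.subset_span ⟨((w * α, w * β), b), rfl⟩
    convert h using 1
    have e : ∀ p : ℝ × ℝ, w * (α * p.1 + β * p.2 + 0) + b = w * α * p.1 + w * β * p.2 + b :=
      fun p => by ring
    ext p i
    simp only [dilateJet, ridgeJet, dilation_apply, ridge_apply, e]
    fin_cases i <;> simp <;> ring
  | zero => simp only [Pi.zero_apply, map_zero]; exact (planeNeuronSpan F).zero_mem
  | add f g _ _ hf hg => simp only [Pi.add_apply, map_add]; exact (planeNeuronSpan F).add_mem hf hg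
  | smul c f _ hf => simp only [Pi.smul_apply, map_smul]; exact (planeNeuronSpan F).smul_mem c hf

theorem exists_network_of_mem_planeNeuronSpan {F : ℝ → ℝ × ℝ × ℝ}
    (hJ : J ∈ planeNeuronSpan F) :
    ∃ N : Network, ∀ t x, J (t, x) 0 = N.output (fun z => (F z).1) t x := by
  obtain ⟨n, c, g, rfl⟩ := Submodule.mem_span_set'.1 hJ
  choose p hp using fun i => (g i).2
  refine ⟨⟨n, fun i => (p i).1, fun i => (p i).2, c⟩, fun t x => ?_⟩
  simp [Network.output, ← hp, Finset.sum_apply, ridgeJet, ridge_apply]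

/-- Polynomial functions of `(t, x)`. -/
noncomputable def planePoly : Submodule ℝ (ℝ → ℝ → ℝ) :=
  Submodule.span ℝ (range fun ij : ℕ × ℕ => fun t x : ℝ => t ^ ij.1 * x ^ ij.2)

theorem monomial_mem_planePoly (i j : ℕ) : (fun t x : ℝ => t ^ i * x ^ j) ∈ planePoly :=
  Submodule.subset_span ⟨(i, j), rfl⟩

/-- Every monomial in two variables is a linear combination of ridge powers. -/
theorem exists_sum_ridge_pow (i j : ℕ) : ∃ c : ℕ → ℝ, ∀ t x : ℝ,
    t ^ i * x ^ j = ∑ k ∈ Finset.range (i + j + 1), c k * (1 * t + k * x + 0) ^ (i + j) := by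
  have hinj : Set.InjOn (fun i : ℕ => (i : ℝ)) (Finset.range (i + j + 1)) :=
    Nat.cast_injective.injOn
  have hch : ((i + j).choose j : ℝ) ≠ 0 := by
    exact_mod_cast (Nat.choose_pos (Nat.le_add_left j i)).ne'
  -- In `(t + y * x) ^ (i + j)` the coefficient of `y ^ j` is the binomial coefficient times the
  -- monomial. Lagrange interpolation at `y = 0, …, i + j` writes this coefficient as a combination
  -- of values, which are ridge powers.
  refine ⟨fun k => ((i + j).choose j : ℝ)⁻¹ *
    (Lagrange.basis (Finset.range (i + j + 1)) (fun i : ℕ => (i : ℝ)) k).coeff j, fun t x => ?_⟩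
  set p : Polynomial ℝ := ∑ m ∈ Finset.range (i + j + 1),
    Polynomial.C (x ^ m * t ^ (i + j - m) * (i + j).choose m) * Polynomial.X ^ m with hp
  have hdeg : p.degree < (Finset.range (i + j + 1)).card := by
    rw [Finset.card_range]
    refine Polynomial.mem_degreeLT.1 (Submodule.sum_mem _ fun m hm => Polynomial.mem_degreeLT.2 ?_)
    exact lt_of_le_of_lt (Polynomial.degree_C_mul_X_pow_le _ _)
      (by exact_mod_cast Finset.mem_range.1 hm)
  have heval : ∀ y : ℝ, p.eval y = (1 * t + y * x + 0) ^ (i + j) := fun y => by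
    rw [show 1 * t + y * x + 0 = y * x + t by ring, add_pow, hp, Polynomial.eval_finsetSum]
    refine Finset.sum_congr rfl fun m _ => ?_
    simp only [Polynomial.eval_mul, Polynomial.eval_C, Polynomial.eval_pow, Polynomial.eval_X]
    ring
  have hcoeff : p.coeff j = x ^ j * t ^ i * (i + j).choose j := by
    rw [hp, Polynomial.finsetSum_coeff]
    simp only [Polynomial.coeff_C_mul_X_pow]
    rw [Finset.sum_ite_eq, if_pos (by simp), Nat.add_sub_cancel]
  rw [Lagrange.eq_interpolate (f := p) hinj hdeg, Lagrange.interpolate_apply,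
    Polynomial.finsetSum_coeff] at hcoeff
  simp only [Polynomial.coeff_C_mul, heval] at hcoeff
  have : t ^ i * x ^ j = ((i + j).choose j : ℝ)⁻¹ * (x ^ j * t ^ i * (i + j).choose j) := by
    field_simp
  rw [this, ← hcoeff, Finset.mul_sum]
  exact Finset.sum_congr rfl fun k _ => by ring

theorem powJet_hasDerivAt (n : ℕ) (z : ℝ) :
    HasDerivAt (fun z => (powJet n z).1) (powJet n z).2.1 z ∧
    HasDerivAt (fun z => (powJet n z).2.1) (powJet n z).2.2 z :=
  ⟨hasDerivAt_pow n z, (hasDerivAt_pow (n - 1) z).const_mul (n : ℝ)⟩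

/-- Ridge powers have jets of both kinds. Carrying membership in `planeJets` along with the closure
ensures that the limiting components are the true derivatives of `f`. -/
theorem exists_jet_of_mem_planePoly {σ : ℝ → ℝ} (hσ : ContDiff ℝ 2 σ)
    (hpoly : ¬ ∃ p : Polynomial ℝ, ∀ z : ℝ, σ z = p.eval z) (hf : f ∈ planePoly) :
    ∃ J ∈ planeJets ⊓
        locUnifClosure (planeNeuronSpan fun z => (σ z, deriv σ z, deriv (deriv σ) z)),
      ∀ t x, J (t, x) 0 = f t x := by
  set S := planeJets ⊓
    locUnifClosure (planeNeuronSpan fun z => (σ z, deriv σ z, deriv (deriv σ) z))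
  induction hf using Submodule.span_induction with
  | mem f hf =>
    obtain ⟨⟨i, j⟩, rfl⟩ := hf
    obtain ⟨c, hc⟩ := exists_sum_ridge_pow i j
    refine ⟨∑ k ∈ Finset.range (i + j + 1), c k • ridgeJet (powJet (i + j)) 1 k 0,
      S.sum_mem fun k _ => S.smul_mem _ ⟨ridgeJet_mem_planeJets
        (fun z => (powJet_hasDerivAt _ z).1) (fun z => (powJet_hasDerivAt _ z).2) _ _ _,
        ridgeJet_mem_locUnifClosure (powJet_mem_locUnifClosure hσ hpoly _) _ _⟩, fun t x => ?_⟩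
    simp only [hc]
    simp [Finset.sum_apply, ridgeJet, ridge_apply, powJet]
  | zero => exact ⟨0, S.zero_mem, fun _ _ => rfl⟩
  | add f g _ _ hf hg =>
    obtain ⟨J, hJ, h⟩ := hf
    obtain ⟨J', hJ', h'⟩ := hg
    exact ⟨J + J', S.add_mem hJ hJ', fun t x => by simp [h, h']⟩
  | smul c f _ hf =>
    obtain ⟨J, hJ, h⟩ := hf
    exact ⟨c • J, S.smul_mem c hJ, fun t x => by simp [h]⟩

/-- Networks approximate polynomials together with their derivatives on compact sets. -/
theorem exists_network_jet_near {σ : ℝ → ℝ} (hσ : ContDiff ℝ 2 σ)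
    (hpoly : ¬ ∃ p : Polynomial ℝ, ∀ z : ℝ, σ z = p.eval z) (hf : f ∈ planePoly)
    {K : Set (ℝ × ℝ)} (hK : IsCompact K) {ε : ℝ} (hε : 0 < ε) :
    ∃ N : Network, ∃ J ∈ planeJets, ∃ G ∈ planeJets, (∀ t x, J (t, x) 0 = f t x) ∧
      (∀ t x, G (t, x) 0 = N.output σ t x) ∧ ∀ p ∈ K, ∀ i, |G p i - J p i| ≤ ε := by
  have hσ' : ContDiff ℝ 1 (deriv σ) := ContDiff.deriv' (by simpa [one_add_one_eq_two] using hσ)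
  obtain ⟨J, ⟨hJ, hJc⟩, hJf⟩ := exists_jet_of_mem_planePoly hσ hpoly hf
  obtain ⟨G, hG, hGJ⟩ := hJc K hK ε hε
  obtain ⟨N, hN⟩ := exists_network_of_mem_planeNeuronSpan hG
  refine ⟨N, J, hJ, G, ?_, hJf, hN, fun p hp i => ?_⟩
  · refine Submodule.span_le.2 ?_ hG
    rintro _ ⟨p, rfl⟩
    exact ridgeJet_mem_planeJets (fun z => (hσ.differentiable (by norm_num) z).hasDerivAt)
      (fun z => (hσ'.differentiable (by norm_num) z).hasDerivAt) _ _ _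
  · exact (norm_le_pi_norm (G p - J p) i).trans (hGJ p hp)

end PlaneJets

/-! ### Polynomial approximate identities. -/

section PolynomialApproximation

theorem continuous_of_mem_planePoly {P : ℝ → ℝ → ℝ} (hP : P ∈ planePoly) :
    Continuous fun q : ℝ × ℝ => P q.1 q.2 := by
  induction hP using Submodule.span_induction with
  | mem f hf => obtain ⟨⟨i, j⟩, rfl⟩ := hf; fun_prop
  | zero => exact continuous_const
  | add f g _ _ hf hg => exact hf.add hg
  | smul c f _ hf => exact hf.const_smul c

theorem const_mem_planePoly (c : ℝ) : (fun _ _ : ℝ => c) ∈ planePoly := by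
  convert planePoly.smul_mem c (monomial_mem_planePoly 0 0) using 1
  funext t x; simp

theorem planePoly_mul_mem {P Q : ℝ → ℝ → ℝ} (hP : P ∈ planePoly) (hQ : Q ∈ planePoly) :
    (fun t x => P t x * Q t x) ∈ planePoly := by
  induction hP using Submodule.span_induction with
  | mem f hf =>
    obtain ⟨⟨i, j⟩, rfl⟩ := hf
    induction hQ using Submodule.span_induction with
    | mem f hf =>
      obtain ⟨⟨i', j'⟩, rfl⟩ := hf
      convert monomial_mem_planePoly (i + i') (j + j') using 3
      ring
    | zero => simpa using const_mem_planePoly 0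
    | add f g _ _ hf hg =>
      convert planePoly.add_mem hf hg using 1
      funext t x; simp [mul_add]
    | smul c f _ hf =>
      convert planePoly.smul_mem c hf using 1
      funext t x; simp; ring
  | zero => simpa using const_mem_planePoly 0
  | add f g _ _ hf hg =>
    convert planePoly.add_mem hf hg using 1
    funext t x; simp [add_mul]
  | smul c f _ hf =>
    convert planePoly.smul_mem c hf using 1
    funext t x; simp; ring

theorem fst_mem_planePoly : (fun t _ : ℝ => t) ∈ planePoly := by
  simpa using monomial_mem_planePoly 1 0

theorem snd_mem_planePoly : (fun _ x : ℝ => x) ∈ planePoly := by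
  simpa using monomial_mem_planePoly 0 1

/-- The Weierstrass approximation theorem in two variables. -/
theorem exists_planePoly_near_continuous {Φ : ℝ × ℝ → ℝ} (hΦ : Continuous Φ) {D : Set (ℝ × ℝ)}
    (hD : IsCompact D) {δ : ℝ} (hδ : 0 < δ) :
    ∃ P ∈ planePoly, ∀ q ∈ D, |P q.1 q.2 - Φ q| ≤ δ := by
  let A : Subalgebra ℝ C(ℝ × ℝ, ℝ) :=
    { carrier := {g | (fun t x => g (t, x)) ∈ planePoly}
      mul_mem' := fun hf hg => planePoly_mul_mem hf hg
      add_mem' := fun hf hg => planePoly.add_mem hf hg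
      algebraMap_mem' := fun r => const_mem_planePoly r }
  have hA : A.SeparatesPoints := by
    intro p q hpq
    by_cases h : p.1 = q.1
    · have h2 : p.2 ≠ q.2 := fun h2 => hpq (Prod.ext h h2)
      exact ⟨_, ⟨⟨Prod.snd, continuous_snd⟩, snd_mem_planePoly, rfl⟩, h2⟩
    · exact ⟨_, ⟨⟨Prod.fst, continuous_fst⟩, fst_mem_planePoly, rfl⟩, h⟩
  obtain ⟨g, hg, h⟩ :=
    ContinuousMap.exists_mem_subalgebra_near_continuous_of_isCompact_of_separatesPoints hA
      ⟨Φ, hΦ⟩ hD hδ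
  exact ⟨_, hg, fun q hq => (h q hq).le⟩

/-- Each factor `t - q.1` or `x - q.2` is split off; the part in `q` is absorbed into `f`, which
stays continuous and compactly supported. -/
theorem integral_monomial_mem_planePoly (i j : ℕ) {f : ℝ × ℝ → ℝ} (hf : Continuous f)
    (hfc : HasCompactSupport f) :
    (fun t x => ∫ q : ℝ × ℝ, (t - q.1) ^ i * (x - q.2) ^ j * f q) ∈ planePoly := by
  induction i generalizing f with
  | zero =>
    induction j generalizing f with
    | zero => simpa using const_mem_planePoly (∫ q, f q)
    | succ j ih =>
      have h1 := planePoly_mul_mem snd_mem_planePoly (ih hf hfc)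
      have h2 := ih (continuous_snd.mul hf) (hfc.mul_left (f := Prod.snd))
      convert planePoly.sub_mem h1 h2 using 1
      funext t x
      simp only [Pi.sub_apply, Pi.mul_apply]
      rw [← integral_const_mul, ← integral_sub]
      · congr 1; funext q; ring
      · exact (Continuous.integrable_of_hasCompactSupport (by fun_prop) hfc.mul_left).const_mul _
      · exact Continuous.integrable_of_hasCompactSupport (by fun_prop) hfc.mul_left.mul_left
  | succ i ih =>
    have h1 := planePoly_mul_mem fst_mem_planePoly (ih hf hfc)
    have h2 := ih (continuous_fst.mul hf) (hfc.mul_left (f := Prod.fst))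
    convert planePoly.sub_mem h1 h2 using 1
    funext t x
    simp only [Pi.sub_apply, Pi.mul_apply]
    rw [← integral_const_mul, ← integral_sub]
    · congr 1; funext q; ring
    · exact (Continuous.integrable_of_hasCompactSupport (by fun_prop) hfc.mul_left).const_mul _
    · exact Continuous.integrable_of_hasCompactSupport (by fun_prop) hfc.mul_left.mul_left

/-- The convolution of a polynomial with a compactly supported function is a polynomial. -/
theorem convolution_mem_planePoly {P : ℝ → ℝ → ℝ} (hP : P ∈ planePoly) {f : ℝ × ℝ → ℝ}
    (hf : Continuous f) (hfc : HasCompactSupport f) :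
    (fun t x => ∫ q : ℝ × ℝ, P q.1 q.2 * f ((t, x) - q)) ∈ planePoly := by
  have hswap : ∀ P : ℝ → ℝ → ℝ, (fun t x => ∫ q : ℝ × ℝ, P q.1 q.2 * f ((t, x) - q))
      = fun t x => ∫ q : ℝ × ℝ, P (t - q.1) (x - q.2) * f q := fun P => by
    funext t x
    rw [← integral_sub_left_eq_self _ volume (t, x)]
    simp
  rw [hswap]
  have hint : ∀ P ∈ planePoly, ∀ t x : ℝ,
      Integrable fun q : ℝ × ℝ => P (t - q.1) (x - q.2) * f q := fun P hP t x =>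
    (((continuous_of_mem_planePoly hP).comp (by fun_prop :
      Continuous fun q : ℝ × ℝ => (t - q.1, x - q.2))).mul hf).integrable_of_hasCompactSupport
      hfc.mul_left
  induction hP using Submodule.span_induction with
  | mem P hP => obtain ⟨⟨i, j⟩, rfl⟩ := hP; exact integral_monomial_mem_planePoly i j hf hfc
  | zero => simpa using const_mem_planePoly 0
  | add P Q hP hQ hP' hQ' =>
    convert planePoly.add_mem hP' hQ' using 1
    funext t x
    simp only [Pi.add_apply, add_mul]
    exact integral_add (hint P hP t x) (hint Q hQ t x)
  | smul c P hP hP' =>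
    convert planePoly.smul_mem c hP' using 1
    funext t x
    simp only [Pi.smul_apply, smul_eq_mul, mul_assoc]
    exact integral_const_mul _ _

/-- Convolution with a continuous function may be differentiated along `v` in the other,
compactly supported factor. -/
theorem hasDerivAt_convolution {P f f' : ℝ × ℝ → ℝ} (hP : Continuous P) (hf : Continuous f)
    (hf' : Continuous f') (hfc : HasCompactSupport f) (hfc' : HasCompactSupport f') (v : ℝ × ℝ)
    (hd : ∀ z s, HasDerivAt (fun s : ℝ => f (z + s • v)) (f' (z + s • v)) s) (z : ℝ × ℝ) (s : ℝ) :
    HasDerivAt (fun s : ℝ => ∫ q, P q * f (z + s • v - q)) (∫ q, P q * f' (z + s • v - q)) s := by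
  have hK : IsCompact ((fun a : ℝ × (ℝ × ℝ) => z + a.1 • v - a.2) ''
      (Metric.closedBall s 1 ×ˢ tsupport f')) :=
    ((isCompact_closedBall s 1).prod hfc'.isCompact).image (by fun_prop)
  refine hasDerivAt_integral_of_isCompact volume (G := fun s q => P q * f (z + s • v - q))
    (G' := fun s q => P q * f' (z + s • v - q)) hK s (fun s => by fun_prop) ?_ (fun s q => ?_)
    (fun r hr q hq => ?_) ?_
  · simp only [Function.uncurry_def]
    fun_prop
  · have := hd (z - q) s
    simp only [sub_add_eq_add_sub] at this
    exact this.const_mul _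
  · rw [image_eq_zero_of_notMem_tsupport (f := f'), mul_zero]
    intro h
    exact hq ⟨(r, z + r • v - q), ⟨Metric.ball_subset_closedBall hr, h⟩, by simp⟩
  · refine Continuous.integrable_of_hasCompactSupport (by fun_prop) (HasCompactSupport.mul_left ?_)
    exact hfc.comp_homeomorph (Homeomorph.subLeft (z + s • v))

/-- Polynomials that act by convolution like an approximate identity. -/
theorem exists_planePoly_convolution_near {ι : Type*} [Finite ι] {F : ι → ℝ × ℝ → ℝ}
    (hF : ∀ i, Continuous (F i)) (hFc : ∀ i, HasCompactSupport (F i)) {K : Set (ℝ × ℝ)}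
    (hK : IsCompact K) {ε : ℝ} (hε : 0 < ε) :
    ∃ P ∈ planePoly, ∀ i, ∀ z ∈ K, |(∫ q : ℝ × ℝ, P q.1 q.2 * F i (z - q)) - F i z| ≤ ε := by
  have _ := Fintype.ofFinite ι
  obtain ⟨η, hη, hη'⟩ : ∃ η > 0, ∀ i, ∀ z w, dist w z < η → dist (F i w) (F i z) < ε / 2 := by
    have : ∀ i, ∃ η > 0, ∀ z w, dist w z < η → dist (F i w) (F i z) < ε / 2 := fun i => by
      obtain ⟨η, hη, h⟩ := Metric.uniformContinuous_iff.1
        ((hFc i).uniformContinuous_of_continuous (hF i)) (ε / 2) (half_pos hε)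
      exact ⟨η, hη, fun z w h' => h h'⟩
    choose η hη h using this
    obtain ⟨m, hm, hm'⟩ : ∃ m > 0, ∀ i, m ≤ η i := by
      rcases isEmpty_or_nonempty ι with he | he
      · exact ⟨1, one_pos, fun i => he.elim i⟩
      · obtain ⟨i₀, h₀⟩ := Finite.exists_min η
        exact ⟨η i₀, hη _, h₀⟩
    exact ⟨m, hm, fun i z w hzw => h i z w (hzw.trans_le (hm' i))⟩
  let φ : ContDiffBump (0 : ℝ × ℝ) := ⟨η / 2, η, half_pos hη, half_lt_self hη⟩
  set I : ℝ := ∑ i, ∫ q, |F i q| with hI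
  have hI0 : ∀ i, 0 ≤ ∫ q, |F i q| := fun i => integral_nonneg fun _ => abs_nonneg _
  have hIi : ∀ i, ∫ q, |F i q| ≤ I := fun i =>
    Finset.single_le_sum (f := fun i => ∫ q, |F i q|) (fun i _ => hI0 i) (Finset.mem_univ i)
  have hI1 : 0 ≤ I := Finset.sum_nonneg fun i _ => hI0 i
  set W : Set (ℝ × ℝ) := ⋃ i, tsupport (F i) with hW
  have hWc : IsCompact W := isCompact_iUnion fun i => (hFc i).isCompact
  -- For `z ∈ K`, only `q ∈ K - W` contribute to the convolution, so the polynomial has to imitate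
  -- the bump only there. Its uniform error is multiplied by `∫ |F i| ≤ I`, whence the tolerance `ε
  -- / (2 * (I + 1))`.
  set D : Set (ℝ × ℝ) := (fun a : (ℝ × ℝ) × (ℝ × ℝ) => a.1 - a.2) '' (K ×ˢ W) with hD
  have hDc : IsCompact D := (hK.prod hWc).image (by fun_prop)
  obtain ⟨P, hP, hPD⟩ := exists_planePoly_near_continuous (φ.continuous_normed (μ := volume)) hDc
    (show 0 < ε / (2 * (I + 1)) by positivity)
  refine ⟨P, hP, fun i z hz => ?_⟩
  have hcs : HasCompactSupport fun q => F i (z - q) := (hFc i).comp_homeomorph (Homeomorph.subLeft z)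
  have hFz : Continuous fun q => F i (z - q) := (hF i).comp (by fun_prop)
  have h1 : |(∫ q, φ.normed volume q * F i (z - q)) - F i z| ≤ ε / 2 := by
    have := φ.dist_normed_convolution_le (μ := volume) (g := F i) (x₀ := z) (ε := ε / 2)
      (hF i).aestronglyMeasurable (fun x hx => (hη' i z x hx).le)
    rwa [Real.dist_eq] at this
  have h2 : |(∫ q : ℝ × ℝ, P q.1 q.2 * F i (z - q)) - ∫ q, φ.normed volume q * F i (z - q)|
      ≤ ε / 2 := by
    have i1 : Integrable fun q : ℝ × ℝ => P q.1 q.2 * F i (z - q) :=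
      ((continuous_of_mem_planePoly hP).mul hFz).integrable_of_hasCompactSupport hcs.mul_left
    have i2 : Integrable fun q => φ.normed volume q * F i (z - q) :=
      (φ.continuous_normed.mul hFz).integrable_of_hasCompactSupport hcs.mul_left
    rw [← integral_sub i1 i2]
    have hb : Integrable fun q => |F i (z - q)| :=
      (hFz.integrable_of_hasCompactSupport hcs).abs
    have h3 := norm_integral_le_of_norm_le (μ := volume) (hb.const_mul (ε / (2 * (I + 1))))
      (f := fun q : ℝ × ℝ => P q.1 q.2 * F i (z - q) - φ.normed volume q * F i (z - q))
      (Eventually.of_forall fun q => by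
        rw [← sub_mul, norm_mul, Real.norm_eq_abs, Real.norm_eq_abs]
        by_cases hq : z - q ∈ tsupport (F i)
        · refine mul_le_mul_of_nonneg_right (hPD q ⟨(z, z - q), ⟨hz, mem_iUnion.2 ⟨i, hq⟩⟩, ?_⟩)
            (abs_nonneg _)
          simp
        · simp [image_eq_zero_of_notMem_tsupport hq])
    rw [integral_const_mul, integral_sub_left_eq_self (fun q => |F i q|) volume z] at h3
    refine h3.trans ?_
    rw [div_mul_eq_mul_div, div_le_div_iff₀ (by positivity) two_pos]
    nlinarith [hIi i]
  have := abs_add_le ((∫ q : ℝ × ℝ, P q.1 q.2 * F i (z - q)) - ∫ q, φ.normed volume q * F i (z - q))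
    ((∫ q, φ.normed volume q * F i (z - q)) - F i z)
  rw [sub_add_sub_cancel] at this
  linarith

end PolynomialApproximation

/-! ### Cutoffs and density of polynomials in `Ĉ^{(1,2)}`. -/

section Cutoff

/-- Off the closed support of `A` the product vanishes locally, so `g` may be arbitrary there. -/
theorem hasDerivAt_cutoff_mul {A g g' : ℝ → ℝ} (hA : Differentiable ℝ A)
    (hg : ∀ t ∈ tsupport A, HasDerivAt g (g' t) t) (t : ℝ) :
    HasDerivAt (fun t => A t * g t) (deriv A t * g t + A t * g' t) t := by
  by_cases ht : t ∈ tsupport A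
  · exact (hA t).hasDerivAt.mul (hg t ht)
  · rw [deriv_of_notMem_tsupport ht, image_eq_zero_of_notMem_tsupport ht]
    have h0 : (fun t => A t * g t) =ᶠ[𝓝 t] fun _ => 0 := by
      filter_upwards [notMem_tsupport_iff_eventuallyEq.1 ht] with s hs
      simp [hs]
    simpa using (hasDerivAt_const t (0 : ℝ)).congr_of_eventuallyEq h0

theorem continuous_cutoff_mul {A B : ℝ → ℝ} (hA : Continuous A) (hB : Continuous B)
    {w : ℝ × ℝ → ℝ} {U : Set (ℝ × ℝ)} (hU : IsOpen U) (hAB : tsupport A ×ˢ tsupport B ⊆ U)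
    (hw : ContinuousOn w U) : Continuous fun p : ℝ × ℝ => A p.1 * B p.2 * w p := by
  refine continuous_iff_continuousAt.2 fun p => ?_
  by_cases hp : p ∈ U
  · exact ((hA.comp continuous_fst).mul (hB.comp continuous_snd)).continuousAt.mul
      (hw.continuousAt (hU.mem_nhds hp))
  · have hcl : IsClosed (tsupport A ×ˢ tsupport B) :=
      (isClosed_tsupport A).prod (isClosed_tsupport B)
    refine (continuousAt_const (y := (0 : ℝ))).congr ?_
    filter_upwards [hcl.isOpen_compl.mem_nhds fun h => hp (hAB h)] with q hq
    by_cases h1 : q.1 ∈ tsupport A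
    · simp [image_eq_zero_of_notMem_tsupport fun h2 => hq ⟨h1, h2⟩]
    · simp [image_eq_zero_of_notMem_tsupport h1]

theorem hasCompactSupport_cutoff_mul {A B : ℝ → ℝ} (hA : HasCompactSupport A)
    (hB : HasCompactSupport B) (w : ℝ × ℝ → ℝ) :
    HasCompactSupport fun p : ℝ × ℝ => A p.1 * B p.2 * w p := by
  refine HasCompactSupport.intro (hA.isCompact.prod hB.isCompact) fun q hq => ?_
  by_cases h1 : q.1 ∈ tsupport A
  · simp [image_eq_zero_of_notMem_tsupport fun h2 => hq ⟨h1, h2⟩]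
  · simp [image_eq_zero_of_notMem_tsupport h1]

/-- Smooth cutoff functions between an interval and its `δ`-neighbourhood. -/
theorem exists_cutoff_Icc {a b δ : ℝ} (hab : a ≤ b) (hδ : 0 < δ) :
    ∃ A : ℝ → ℝ, ContDiff ℝ 2 A ∧ HasCompactSupport A ∧ tsupport A ⊆ Icc (a - δ) (b + δ) ∧
      ∀ t ∈ Icc a b, A t = 1 ∧ deriv A t = 0 ∧ deriv (deriv A) t = 0 := by
  let φ : ContDiffBump ((a + b) / 2) := ⟨(b - a) / 2 + δ / 2, (b - a) / 2 + δ, by linarith,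
    by linarith⟩
  refine ⟨φ, φ.contDiff, φ.hasCompactSupport, ?_, fun t ht => ?_⟩
  · rw [φ.tsupport_eq, Real.closedBall_eq_Icc]
    apply Icc_subset_Icc
    · change _ ≤ (a + b) / 2 - ((b - a) / 2 + δ); linarith
    · change (a + b) / 2 + ((b - a) / 2 + δ) ≤ _; linarith
  · have h : (φ : ℝ → ℝ) =ᶠ[𝓝 t] fun _ => 1 := φ.eventuallyEq_one_of_mem_ball (by
      rw [Real.ball_eq_Ioo]
      constructor
      · change (a + b) / 2 - ((b - a) / 2 + δ / 2) < t; linarith [ht.1]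
      · change t < (a + b) / 2 + ((b - a) / 2 + δ / 2); linarith [ht.2])
    refine ⟨h.eq_of_nhds, ?_, ?_⟩
    · rw [h.deriv_eq]; simp
    · rw [h.deriv.deriv_eq]; simp

/-- A product cutoff `A(t) B(x)` equal to `1` near the rectangle does it: the product rule then
produces only derivatives of `u` known to exist, and never a mixed one. -/
theorem exists_compactlySupported_extension {u : ℝ → ℝ → ℝ} {a b c d : ℝ} (hab : a ≤ b)
    (hcd : c ≤ d) (hu : IsHatC12 u (Icc a b ×ˢ Icc c d)) :
    ∃ F : Fin 4 → ℝ × ℝ → ℝ, (∀ i, Continuous (F i)) ∧ (∀ i, HasCompactSupport (F i)) ∧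
      (∀ t x, HasDerivAt (fun s => F 0 (s, x)) (F 1 (t, x)) t) ∧
      (∀ t x, HasDerivAt (fun y => F 0 (t, y)) (F 2 (t, x)) x) ∧
      (∀ t x, HasDerivAt (fun y => F 2 (t, y)) (F 3 (t, x)) x) ∧
      ∀ t ∈ Icc a b, ∀ x ∈ Icc c d, F 0 (t, x) = u t x ∧ F 1 (t, x) = dt u t x ∧
        F 2 (t, x) = dx u t x ∧ F 3 (t, x) = dx (dx u) t x := by
  obtain ⟨U, hU, hKU, hu⟩ := hu
  obtain ⟨δ, hδ, hδU⟩ := (isCompact_Icc.prod isCompact_Icc).exists_cthickening_subset_open hU hKU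
  obtain ⟨A, hA, hAc, hAs, hA1⟩ := exists_cutoff_Icc hab hδ
  obtain ⟨B, hB, hBc, hBs, hB1⟩ := exists_cutoff_Icc hcd hδ
  have hAB : tsupport A ×ˢ tsupport B ⊆ U := by
    rintro ⟨t, x⟩ ⟨ht, hx⟩
    have ht := hAs ht
    have hx := hBs hx
    -- Clamping both coordinates gives a point of the rectangle within `δ` in the maximum metric.
    refine hδU (Metric.mem_cthickening_of_dist_le (t, x) (max a (min t b), max c (min x d)) δ _
      ⟨⟨le_max_left _ _, max_le hab (min_le_right _ _)⟩,
        ⟨le_max_left _ _, max_le hcd (min_le_right _ _)⟩⟩ ?_)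
    rw [Prod.dist_eq, Real.dist_eq, Real.dist_eq]
    simp only [mem_Icc] at ht hx
    refine max_le ?_ ?_ <;> rw [abs_le] <;> constructor <;>
      rcases max_cases a (min t b) with h | h <;> rcases min_cases t b with h' | h' <;>
      rcases max_cases c (min x d) with k | k <;> rcases min_cases x d with k' | k' <;> linarith
  have hA' : ContDiff ℝ 1 (deriv A) := ContDiff.deriv' (by simpa [one_add_one_eq_two] using hA)
  have hB' : ContDiff ℝ 1 (deriv B) := ContDiff.deriv' (by simpa [one_add_one_eq_two] using hB)
  have hB'' : ContDiff ℝ 0 (deriv (deriv B)) := ContDiff.deriv' (by simpa using hB')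
  have hAs' : tsupport (deriv A) ⊆ tsupport A := tsupport_deriv_subset
  have hBs' : tsupport (deriv B) ⊆ tsupport B := tsupport_deriv_subset
  have hBs'' : tsupport (deriv (deriv B)) ⊆ tsupport B := tsupport_deriv_subset.trans hBs'
  have hAd : Differentiable ℝ A := hA.differentiable (by norm_num)
  have hBd : Differentiable ℝ B := hB.differentiable (by norm_num)
  have hBd' : Differentiable ℝ (deriv B) := hB'.differentiable (by norm_num)
  let F : Fin 4 → ℝ × ℝ → ℝ := ![
    fun p => A p.1 * B p.2 * u p.1 p.2,
    fun p => deriv A p.1 * B p.2 * u p.1 p.2 + A p.1 * B p.2 * dt u p.1 p.2,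
    fun p => A p.1 * deriv B p.2 * u p.1 p.2 + A p.1 * B p.2 * dx u p.1 p.2,
    fun p => A p.1 * deriv (deriv B) p.2 * u p.1 p.2 + (A p.1 * deriv B p.2 * dx u p.1 p.2
      + (A p.1 * deriv B p.2 * dx u p.1 p.2 + A p.1 * B p.2 * dx (dx u) p.1 p.2))]
  have mk : ∀ {A' B' : ℝ → ℝ} {w : ℝ × ℝ → ℝ}, Continuous A' → Continuous B' →
      tsupport A' ⊆ tsupport A → tsupport B' ⊆ tsupport B → ContinuousOn w U →
      Continuous (fun p : ℝ × ℝ => A' p.1 * B' p.2 * w p) ∧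
      HasCompactSupport (fun p : ℝ × ℝ => A' p.1 * B' p.2 * w p) := by
    intro A' B' w h1 h2 h3 h4 h5
    exact ⟨continuous_cutoff_mul h1 h2 hU ((prod_mono h3 h4).trans hAB) h5,
      hasCompactSupport_cutoff_mul (hAc.mono' ((subset_tsupport _).trans h3))
        (hBc.mono' ((subset_tsupport _).trans h4)) w⟩
  have m0 := mk hA.continuous hB.continuous subset_rfl subset_rfl hu.cont
  have m1 := mk hA'.continuous hB.continuous hAs' subset_rfl hu.cont
  have m2 := mk hA.continuous hB.continuous subset_rfl subset_rfl hu.cont_t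
  have m3 := mk hA.continuous hB'.continuous subset_rfl hBs' hu.cont
  have m4 := mk hA.continuous hB.continuous subset_rfl subset_rfl hu.cont_x
  have m5 := mk hA.continuous hB''.continuous subset_rfl hBs'' hu.cont
  have m6 := mk hA.continuous hB'.continuous subset_rfl hBs' hu.cont_x
  have m7 := mk hA.continuous hB.continuous subset_rfl subset_rfl hu.cont_xx
  refine ⟨F, fun i => ?_, fun i => ?_, fun t x => ?_, fun t x => ?_, fun t x => ?_,
    fun t ht x hx => ?_⟩
  · fin_cases i
    exacts [m0.1, m1.1.add m2.1, m3.1.add m4.1, m5.1.add (m6.1.add (m6.1.add m7.1))]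
  · fin_cases i
    exacts [m0.2, m1.2.add m2.2, m3.2.add m4.2, m5.2.add (m6.2.add (m6.2.add m7.2))]
  · change HasDerivAt (fun s => A s * B x * u s x)
      (deriv A t * B x * u t x + A t * B x * dt u t x) t
    by_cases hx : x ∈ tsupport B
    · have := (hasDerivAt_cutoff_mul (g := fun s => u s x) (g' := fun s => dt u s x) hAd
        (fun s hs => (hu.diff_t (s, x) (hAB ⟨hs, hx⟩)).hasDerivAt) t).const_mul (B x)
      exact (this.congr_deriv (by ring)).congr_of_eventuallyEq
        (Eventually.of_forall fun s => by ring)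
    · simpa [image_eq_zero_of_notMem_tsupport hx] using hasDerivAt_const t (0 : ℝ)
  · change HasDerivAt (fun y => A t * B y * u t y)
      (A t * deriv B x * u t x + A t * B x * dx u t x) x
    by_cases ht : t ∈ tsupport A
    · have := (hasDerivAt_cutoff_mul (g := fun y => u t y) (g' := fun y => dx u t y) hBd
        (fun y hy => (hu.diff_x (t, y) (hAB ⟨ht, hy⟩)).hasDerivAt) x).const_mul (A t)
      exact (this.congr_deriv (by ring)).congr_of_eventuallyEq
        (Eventually.of_forall fun s => by ring)
    · simpa [image_eq_zero_of_notMem_tsupport ht] using hasDerivAt_const x (0 : ℝ)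
  · change HasDerivAt (fun y => A t * deriv B y * u t y + A t * B y * dx u t y)
      (A t * deriv (deriv B) x * u t x + (A t * deriv B x * dx u t x
        + (A t * deriv B x * dx u t x + A t * B x * dx (dx u) t x))) x
    by_cases ht : t ∈ tsupport A
    · have h1 := (hasDerivAt_cutoff_mul (g := fun y => u t y) (g' := fun y => dx u t y) hBd'
        (fun y hy => (hu.diff_x (t, y) (hAB ⟨ht, hBs' hy⟩)).hasDerivAt) x).const_mul (A t)
      have h2 := (hasDerivAt_cutoff_mul (g := fun y => dx u t y) (g' := fun y => dx (dx u) t y) hBd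
        (fun y hy => (hu.diff_xx (t, y) (hAB ⟨ht, hy⟩)).hasDerivAt) x).const_mul (A t)
      exact ((h1.add h2).congr_deriv (by ring)).congr_of_eventuallyEq
        (Eventually.of_forall fun s => by simp only [Pi.add_apply]; ring)
    · simpa [image_eq_zero_of_notMem_tsupport ht] using hasDerivAt_const x (0 : ℝ)
  · obtain ⟨a1, a2, -⟩ := hA1 t ht
    obtain ⟨b1, b2, b3⟩ := hB1 x hx
    simp [F, a1, a2, b1, b2, b3]

/-- Polynomials are dense in `Ĉ^{(1,2)}` of a rectangle. -/
theorem exists_planePoly_near {u : ℝ → ℝ → ℝ} {a b c d : ℝ} (hab : a ≤ b)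
    (hcd : c ≤ d) (hu : IsHatC12 u (Icc a b ×ˢ Icc c d)) {ε : ℝ} (hε : 0 < ε) :
    ∃ p ∈ planePoly, ∀ t ∈ Icc a b, ∀ x ∈ Icc c d, |p t x - u t x| ≤ ε ∧
      |dt p t x - dt u t x| ≤ ε ∧ |dx p t x - dx u t x| ≤ ε ∧
      |dx (dx p) t x - dx (dx u) t x| ≤ ε := by
  obtain ⟨F, hF, hFc, ht, hx, hxx, hK⟩ := exists_compactlySupported_extension hab hcd hu
  obtain ⟨P, hP, hPF⟩ := exists_planePoly_convolution_near hF hFc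
    (isCompact_Icc.prod isCompact_Icc : IsCompact (Icc a b ×ˢ Icc c d)) hε
  have hPc := continuous_of_mem_planePoly hP
  -- All derivatives fall on the factors `F i`, so one polynomial kernel handles `u` and its three
  -- derivatives simultaneously.
  let g : Fin 4 → ℝ → ℝ → ℝ := fun i t x => ∫ q : ℝ × ℝ, P q.1 q.2 * F i ((t, x) - q)
  have derT : ∀ i j, (∀ t x, HasDerivAt (fun s => F i (s, x)) (F j (t, x)) t) →
      dt (g i) = g j := fun i j h => by
    funext t x
    have := hasDerivAt_convolution hPc (hF i) (hF j) (hFc i) (hFc j) (1, 0)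
      (fun z s => by simpa [Prod.add_def] using (h (z.1 + s) z.2).comp_const_add z.1 s) (0, x) t
    simp only [Prod.smul_mk, smul_eq_mul, mul_one, mul_zero, Prod.mk_add_mk, zero_add,
      add_zero] at this
    exact this.deriv
  have derX : ∀ i j, (∀ t x, HasDerivAt (fun y => F i (t, y)) (F j (t, x)) x) →
      dx (g i) = g j := fun i j h => by
    funext t x
    have := hasDerivAt_convolution hPc (hF i) (hF j) (hFc i) (hFc j) (0, 1)
      (fun z s => by simpa [Prod.add_def] using (h z.1 (z.2 + s)).comp_const_add z.2 s) (t, 0) x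
    simp only [Prod.smul_mk, smul_eq_mul, mul_one, mul_zero, Prod.mk_add_mk, zero_add,
      add_zero] at this
    exact this.deriv
  refine ⟨g 0, convolution_mem_planePoly hP (hF 0) (hFc 0), fun t h1 x h2 => ?_⟩
  obtain ⟨e0, e1, e2, e3⟩ := hK t h1 x h2
  rw [derT 0 1 ht, derX 0 2 hx, derX 2 3 hxx, ← e0, ← e1, ← e2, ← e3]
  exact ⟨hPF 0 _ ⟨h1, h2⟩, hPF 1 _ ⟨h1, h2⟩, hPF 2 _ ⟨h1, h2⟩, hPF 3 _ ⟨h1, h2⟩⟩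

end Cutoff

/-! ### Antiderivatives and approximation of the background charge. -/

section Antiderivative

/-- Antiderivatives in `x` of polynomials, and of their time derivatives. -/
theorem exists_planePoly_antiderivative {p : ℝ → ℝ → ℝ} (hp : p ∈ planePoly) :
    ∃ q ∈ planePoly, ∃ p' q' : ℝ → ℝ → ℝ, ∀ t x,
      HasDerivAt (fun s => p s x) (p' t x) t ∧ HasDerivAt (fun y => q t y) (p t x) x ∧
      HasDerivAt (fun s => q s x) (q' t x) t ∧ HasDerivAt (fun y => q' t y) (p' t x) x ∧
      q t (-1) = 0 ∧ q' t (-1) = 0 := by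
  induction hp using Submodule.span_induction with
  | mem p hp =>
    obtain ⟨⟨i, j⟩, rfl⟩ := hp
    have hX : ∀ x : ℝ, HasDerivAt (fun y : ℝ => (y ^ (j + 1) - (-1) ^ (j + 1)) / (j + 1)) (x ^ j) x :=
      fun x => by
        have h := (((hasDerivAt_pow (j + 1) x).sub_const ((-1) ^ (j + 1))).div_const ((j : ℝ) + 1))
        refine h.congr_deriv ?_
        have : (j : ℝ) + 1 ≠ 0 := by positivity
        push_cast
        field_simp
    refine ⟨fun t x => t ^ i * ((x ^ (j + 1) - (-1) ^ (j + 1)) / (j + 1)), ?_,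
      fun t x => i * t ^ (i - 1) * x ^ j,
      fun t x => i * t ^ (i - 1) * ((x ^ (j + 1) - (-1) ^ (j + 1)) / (j + 1)), fun t x => ?_⟩
    · have h1 := planePoly.smul_mem ((j : ℝ) + 1)⁻¹ (monomial_mem_planePoly i (j + 1))
      have h2 := planePoly.smul_mem (-((j : ℝ) + 1)⁻¹ * (-1) ^ (j + 1)) (monomial_mem_planePoly i 0)
      convert planePoly.add_mem h1 h2 using 1
      funext t x
      simp only [Pi.add_apply, Pi.smul_apply, smul_eq_mul, div_eq_mul_inv]
      ring
    · exact ⟨(hasDerivAt_pow i t).mul_const _, (hX x).const_mul _, (hasDerivAt_pow i t).mul_const _,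
        (hX x).const_mul _, by simp, by simp⟩
  | zero =>
    exact ⟨0, planePoly.zero_mem, 0, 0, fun t x => ⟨hasDerivAt_const _ _, hasDerivAt_const _ _,
      hasDerivAt_const _ _, hasDerivAt_const _ _, rfl, rfl⟩⟩
  | add f g _ _ hf hg =>
    obtain ⟨q, hq, p', q', h⟩ := hf
    obtain ⟨r, hr, s', r', k⟩ := hg
    refine ⟨q + r, planePoly.add_mem hq hr, p' + s', q' + r', fun t x => ?_⟩
    obtain ⟨h1, h2, h3, h4, h5, h6⟩ := h t x
    obtain ⟨k1, k2, k3, k4, k5, k6⟩ := k t x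
    exact ⟨h1.add k1, h2.add k2, h3.add k3, h4.add k4, by simp [h5, k5], by simp [h6, k6]⟩
  | smul c f _ hf =>
    obtain ⟨q, hq, p', q', h⟩ := hf
    refine ⟨c • q, planePoly.smul_mem c hq, c • p', c • q', fun t x => ?_⟩
    obtain ⟨h1, h2, h3, h4, h5, h6⟩ := h t x
    exact ⟨h1.const_mul c, h2.const_mul c, h3.const_mul c, h4.const_mul c, by simp [h5],
      by simp [h6]⟩

theorem exists_polynomial_derivative_eq (s : Polynomial ℝ) :
    ∃ Q : Polynomial ℝ, Q.derivative = s := by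
  induction s using Polynomial.induction_on' with
  | add p q hp hq =>
    obtain ⟨P, rfl⟩ := hp
    obtain ⟨Q, rfl⟩ := hq
    exact ⟨P + Q, Polynomial.derivative_add⟩
  | monomial n a =>
    refine ⟨Polynomial.monomial (n + 1) (a / (n + 1)), ?_⟩
    have : (n : ℝ) + 1 ≠ 0 := by positivity
    rw [Polynomial.derivative_monomial]
    simp [this]

theorem eval_mem_planePoly (s : Polynomial ℝ) : (fun _ x : ℝ => s.eval x) ∈ planePoly := by
  induction s using Polynomial.induction_on' with
  | add p q hp hq =>
    convert planePoly.add_mem hp hq using 1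
    funext t x; simp
  | monomial n a =>
    convert planePoly.smul_mem a (monomial_mem_planePoly 0 n) using 1
    funext t x; simp

/-- The derivative is approximated first and then integrated, with the constant fixed at `-1`. The
tolerance `δ / 2` compensates for the interval length `2`. -/
theorem exists_polynomial_near_C1 {h : ℝ → ℝ} (hh : ContDiffOn ℝ 1 h (Icc (-1) 1)) {δ : ℝ}
    (hδ : 0 < δ) : ∃ η : Polynomial ℝ, ∀ x ∈ Icc (-1 : ℝ) 1, |η.eval x - h x| ≤ δ ∧
      |η.derivative.eval x - derivWithin h (Icc (-1) 1) x| ≤ δ := by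
  have hu : UniqueDiffOn ℝ (Icc (-1 : ℝ) 1) := uniqueDiffOn_Icc (by norm_num)
  obtain ⟨s, hs⟩ := exists_polynomial_near_of_continuousOn (-1) 1 _
    (hh.continuousOn_derivWithin hu le_rfl) (δ / 2) (half_pos hδ)
  obtain ⟨Q, rfl⟩ := exists_polynomial_derivative_eq s
  refine ⟨Q + Polynomial.C (h (-1) - Q.eval (-1)), fun x hx => ⟨?_, ?_⟩⟩
  · have hd : ∀ y ∈ Icc (-1 : ℝ) 1, HasDerivWithinAt (fun y => Q.eval y - h y)
        (Q.derivative.eval y - derivWithin h (Icc (-1) 1) y) (Icc (-1) 1) y := fun y hy =>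
      (Q.hasDerivAt y).hasDerivWithinAt.sub
        ((hh.differentiableOn (by norm_num)) y hy).hasDerivWithinAt
    have := (convex_Icc (-1 : ℝ) 1).norm_image_sub_le_of_norm_hasDerivWithin_le hd
      (fun y hy => (hs y hy).le) (x := -1) (y := x) (by simp) hx
    rw [Real.norm_eq_abs, Real.norm_eq_abs, abs_of_nonneg (by linarith [hx.1] : 0 ≤ x - -1)] at this
    rw [Polynomial.eval_add, Polynomial.eval_C]
    calc _ = |Q.eval x - h x - (Q.eval (-1) - h (-1))| := by congr 1; ring
      _ ≤ δ / 2 * (x - -1) := this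
      _ ≤ δ := by nlinarith [hx.2]
  · rw [Polynomial.derivative_add, Polynomial.derivative_C, add_zero]
    linarith [hs x hx]

/-- Mean value theorem, with the derivative needed only inside the interval, where the equations
hold. It bounds the field, the field error and the boundary error of `∂_t q`. -/
theorem abs_le_two_mul_of_hasDerivAt {f f' : ℝ → ℝ} {C : ℝ}
    (hf : ContinuousOn f (Icc (-1) 1)) (hd : ∀ x ∈ Ioo (-1 : ℝ) 1, HasDerivAt f (f' x) x)
    (hC : ∀ x ∈ Ioo (-1 : ℝ) 1, |f' x| ≤ C) (h0 : f (-1) = 0) {x : ℝ} (hx : x ∈ Icc (-1 : ℝ) 1) :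
    |f x| ≤ 2 * C := by
  have hC0 : 0 ≤ C := (abs_nonneg _).trans (hC 0 (by norm_num))
  rcases hx.1.eq_or_lt with h1 | h1
  · rw [← h1, h0, abs_zero]; positivity
  · obtain ⟨c, hc, hfc⟩ := exists_hasDerivAt_eq_slope f f' h1
      (hf.mono (Icc_subset_Icc_right hx.2)) fun y hy => hd y ⟨hy.1, hy.2.trans_le hx.2⟩
    have hpos : 0 < x - -1 := by linarith
    rw [h0, sub_zero, eq_div_iff hpos.ne'] at hfc
    rw [← hfc, abs_mul, abs_of_pos hpos, mul_comm]
    exact mul_le_mul (by linarith [hx.2]) (hC c ⟨hc.1, hc.2.trans_le hx.2⟩) (abs_nonneg _) two_pos.le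

end Antiderivative

/-! ### Bounding the loss by uniform residuals. -/

section Loss

/-- No measurability is required: a nonintegrable function has integral `0`, which satisfies the
bound. -/
theorem sqBulk_le {T c : ℝ} (hT : 0 < T) {u : ℝ → ℝ → ℝ}
    (hu : ∀ t ∈ Ioo 0 T, ∀ x ∈ Ioo (-1 : ℝ) 1, |u t x| ≤ c) : sqBulk T u ≤ 2 * T * c ^ 2 := by
  have h1 : ∀ t ∈ Ioo 0 T, ‖∫ x in Ioo (-1 : ℝ) 1, |u t x| ^ 2‖ ≤ 2 * c ^ 2 := fun t ht => by
    refine (norm_setIntegral_le_of_norm_le_const (C := c ^ 2) measure_Ioo_lt_top fun x hx => ?_).trans_eq ?_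
    · rw [norm_pow, Real.norm_eq_abs, abs_abs]
      exact pow_le_pow_left₀ (abs_nonneg _) (hu t ht x hx) 2
    · rw [Real.volume_real_Ioo_of_le (by norm_num)]; ring
  refine (Real.le_norm_self _).trans
    ((norm_setIntegral_le_of_norm_le_const (C := 2 * c ^ 2) measure_Ioo_lt_top h1).trans_eq ?_)
  rw [Real.volume_real_Ioo_of_le hT.le]; ring

theorem sqBdry_le {T c : ℝ} (hT : 0 < T) {u : ℝ → ℝ → ℝ}
    (hu : ∀ t ∈ Ioo 0 T, ∀ x ∈ ({-1, 1} : Set ℝ), |u t x| ≤ c) : sqBdry T u ≤ 2 * T * c ^ 2 := by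
  unfold sqBdry
  refine (Real.le_norm_self _).trans
    ((norm_setIntegral_le_of_norm_le_const (C := 2 * c ^ 2) measure_Ioo_lt_top fun t ht => ?_).trans_eq ?_)
  · rw [Real.norm_of_nonneg (by positivity)]
    have h1 := pow_le_pow_left₀ (abs_nonneg _) (hu t ht (-1) (by simp)) 2
    have h2 := pow_le_pow_left₀ (abs_nonneg _) (hu t ht 1 (by simp)) 2
    linarith
  · rw [Real.volume_real_Ioo_of_le hT.le]; ring

theorem setIntegral_sq_le {c : ℝ} {u : ℝ → ℝ} (hu : ∀ x ∈ Ioo (-1 : ℝ) 1, |u x| ≤ c) :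
    ∫ x in Ioo (-1 : ℝ) 1, |u x| ^ 2 ≤ 2 * c ^ 2 := by
  refine (Real.le_norm_self _).trans
    ((norm_setIntegral_le_of_norm_le_const (C := c ^ 2) measure_Ioo_lt_top fun x hx => ?_).trans_eq ?_)
  · rw [norm_pow, Real.norm_eq_abs, abs_abs]
    exact pow_le_pow_left₀ (abs_nonneg _) (hu x hx) 2
  · rw [Real.volume_real_Ioo_of_le (by norm_num)]; ring

theorem lossTotal_nonneg (T : ℝ) (h ρ₀ : ℝ → ℝ) (r e : ℝ → ℝ → ℝ) :
    0 ≤ lossTotal T h ρ₀ r e := by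
  unfold lossTotal lossGE lossGE1 lossGE2 lossIC lossIC1 lossIC2 lossBC lossBC1 lossBC2 sqBulk sqBdry
  positivity

/-- Four bulk and three boundary terms contribute `2 * T * c ^ 2` each, two initial terms `2 * c ^
2` each. -/
theorem lossTotal_le {T c : ℝ} (hT : 0 < T) {h ρ₀ : ℝ → ℝ} {r e : ℝ → ℝ → ℝ}
    (hbulk : ∀ t ∈ Ioo 0 T, ∀ x ∈ Ioo (-1 : ℝ) 1, |resNP r e t x| ≤ c ∧
      |resPoisson h r e t x| ≤ c ∧ |dt (resPoisson h r e) t x| ≤ c ∧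
      |dx (resPoisson h r e) t x| ≤ c)
    (hinit : ∀ x ∈ Ioo (-1 : ℝ) 1, |r 0 x - ρ₀ x| ≤ c ∧
      |e 0 x - ((∫ y in (-1)..x, ρ₀ y) - ∫ y in (-1)..x, h y)| ≤ c)
    (hbdry : ∀ t ∈ Ioo 0 T, ∀ x ∈ ({-1, 1} : Set ℝ), |dx r t x| ≤ c ∧ |e t x| ≤ c ∧
      |dt e t x| ≤ c) :
    lossTotal T h ρ₀ r e ≤ (14 * T + 4) * c ^ 2 := by
  have a1 := sqBulk_le hT fun t ht x hx => (hbulk t ht x hx).1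
  have a2 := sqBulk_le hT fun t ht x hx => (hbulk t ht x hx).2.1
  have a3 := sqBulk_le hT fun t ht x hx => (hbulk t ht x hx).2.2.1
  have a4 := sqBulk_le hT fun t ht x hx => (hbulk t ht x hx).2.2.2
  have b1 := setIntegral_sq_le fun x hx => (hinit x hx).1
  have b2 := setIntegral_sq_le fun x hx => (hinit x hx).2
  have c1 := sqBdry_le hT fun t ht x hx => (hbdry t ht x hx).1
  have c2 := sqBdry_le hT fun t ht x hx => (hbdry t ht x hx).2.1
  have c3 := sqBdry_le hT fun t ht x hx => (hbdry t ht x hx).2.2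
  unfold lossTotal lossGE lossGE1 lossGE2 lossIC lossIC1 lossIC2 lossBC lossBC1 lossBC2
  linarith

end Loss

/-! ### Consequences of the equations for the exact solution. -/

section Solution

variable {T : ℝ} {h ρ₀ : ℝ → ℝ} {ρ E : ℝ → ℝ → ℝ}

/-- Poisson's equation at time `0` is integrated from `-1`, where the field vanishes. Since `ρ₀` is
prescribed only on the open interval, endpoints are discarded as null sets. -/
theorem IsSolution.field_initial (hT : 0 < T) (hsol : IsSolution T h ρ₀ ρ E)
    (hh : ContinuousOn h (Icc (-1) 1)) (hρ : ContinuousOn (ρ 0) (Icc (-1) 1)) {x : ℝ}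
    (hx : x ∈ Ioo (-1 : ℝ) 1) :
    (∫ y in (-1)..x, ρ₀ y) - ∫ y in (-1)..x, h y = E 0 x := by
  have h0 : (0 : ℝ) ∈ Icc 0 T := ⟨le_rfl, hT.le⟩
  have hsub : Icc (-1) x ⊆ Icc (-1 : ℝ) 1 := Icc_subset_Icc_right hx.2.le
  have i1 : IntervalIntegrable (ρ 0) volume (-1) x :=
    (hρ.mono hsub).intervalIntegrable_of_Icc hx.1.le
  have i2 : IntervalIntegrable h volume (-1) x :=
    (hh.mono hsub).intervalIntegrable_of_Icc hx.1.le
  have e1 : ∫ y in (-1)..x, ρ₀ y = ∫ y in (-1)..x, ρ 0 y := by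
    rw [intervalIntegral.integral_of_le hx.1.le, intervalIntegral.integral_of_le hx.1.le,
      integral_Ioc_eq_integral_Ioo, integral_Ioc_eq_integral_Ioo]
    exact setIntegral_congr_fun measurableSet_Ioo fun y hy =>
      (hsol.initial y ⟨hy.1, hy.2.trans hx.2⟩).symm
  rw [e1, ← intervalIntegral.integral_sub i1 i2,
    intervalIntegral.integral_eq_sub_of_hasDerivAt_of_le hx.1.le
      ((hsol.field_cont 0 h0).mono hsub) (fun y hy => hsol.poisson 0 h0 y ⟨hy.1, hy.2.trans hx.2⟩)
      (i1.sub i2), (hsol.dirichlet 0 h0).1, sub_zero]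

/-- With zero field on the boundary, no flux becomes the Neumann condition that the loss penalizes.
-/
theorem IsSolution.dx_density_boundary (hsol : IsSolution T h ρ₀ ρ E) {t : ℝ} (ht : t ∈ Icc 0 T)
    {x : ℝ} (hx : x ∈ ({-1, 1} : Set ℝ)) : dx ρ t x = 0 := by
  have := hsol.no_flux t ht x hx
  obtain ⟨h1, h2⟩ := hsol.dirichlet t ht
  rcases hx with rfl | rfl
  · simpa [h1] using this
  · simpa [h2] using this

theorem abs_mul_sub_mul_le {a b a₀ b₀ α β M : ℝ} (ha : |a - a₀| ≤ α) (hb : |b - b₀| ≤ β)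
    (ha₀ : |a₀| ≤ M) (hb₀ : |b₀| ≤ M) : |a * b - a₀ * b₀| ≤ α * (M + β) + M * β := by
  have h1 : a * b - a₀ * b₀ = (a - a₀) * (b₀ + (b - b₀)) + a₀ * (b - b₀) := by ring
  have hM : 0 ≤ M := (abs_nonneg _).trans ha₀
  have hα : 0 ≤ α := (abs_nonneg _).trans ha
  rw [h1]
  refine (abs_add_le _ _).trans (add_le_add ?_ ?_)
  · rw [abs_mul]
    exact mul_le_mul ha ((abs_add_le _ _).trans (add_le_add hb₀ hb)) (abs_nonneg _) hα
  · rw [abs_mul]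
    exact mul_le_mul ha₀ hb (abs_nonneg _) hM

end Solution

/-! ### Assembly of the residual estimates. -/

section Approximation

variable {T : ℝ} {h ρ₀ : ℝ → ℝ} {ρ E : ℝ → ℝ → ℝ}

/-- Networks whose residuals in the Poisson-Nernst-Planck system are uniformly small. -/
theorem exists_networks_lossTotal_le (hT : 0 < T) (hh : ContDiffOn ℝ 1 h (Icc (-1) 1))
    (hsol : IsSolution T h ρ₀ ρ E) (hρ : IsHatC12 ρ (Icc 0 T ×ˢ Icc (-1) 1))
    {σ : ℝ → ℝ} (hσ : ContDiff ℝ 2 σ)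
    (hpoly : ¬ ∃ p : Polynomial ℝ, ∀ z : ℝ, σ z = p.eval z) :
    ∃ C : ℝ, ∀ δ : ℝ, 0 < δ → δ ≤ 1 → ∃ N M : Network,
      lossTotal T h ρ₀ (N.output σ) (M.output σ) ≤ (14 * T + 4) * (C * δ) ^ 2 := by
  obtain ⟨U, -, hKU, hU⟩ := id hρ
  have hK : IsCompact (Icc 0 T ×ˢ Icc (-1 : ℝ) 1) := isCompact_Icc.prod isCompact_Icc
  -- bounds for the solution
  obtain ⟨M₁, hM₁⟩ := hK.exists_bound_of_continuousOn (hU.cont.mono hKU)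
  obtain ⟨M₂, hM₂⟩ := hK.exists_bound_of_continuousOn (hU.cont_x.mono hKU)
  obtain ⟨M₃, hM₃⟩ := (isCompact_Icc (a := (-1 : ℝ)) (b := 1)).exists_bound_of_continuousOn
    hh.continuousOn
  have k1 : ∀ t ∈ Icc 0 T, ∀ x ∈ Icc (-1 : ℝ) 1, |ρ t x| ≤ M₁ := fun t ht x hx => hM₁ (t, x) ⟨ht, hx⟩
  have k2 : ∀ t ∈ Icc 0 T, ∀ x ∈ Icc (-1 : ℝ) 1, |dx ρ t x| ≤ M₂ :=
    fun t ht x hx => hM₂ (t, x) ⟨ht, hx⟩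
  have k3 : ∀ t ∈ Icc 0 T, ∀ x ∈ Icc (-1 : ℝ) 1, |ρ t x - h x| ≤ M₁ + M₃ := fun t ht x hx =>
    (abs_sub _ _).trans (add_le_add (k1 t ht x hx) (hM₃ x hx))
  have k4 : ∀ t ∈ Icc 0 T, ∀ x ∈ Icc (-1 : ℝ) 1, |E t x| ≤ 2 * (M₁ + M₃) := fun t ht x hx =>
    abs_le_two_mul_of_hasDerivAt (hsol.field_cont t ht) (hsol.poisson t ht)
      (fun y hy => k3 t ht y (Ioo_subset_Icc_self hy)) (hsol.dirichlet t ht).1 hx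
  have h0T : (0 : ℝ) ∈ Icc 0 T := ⟨le_rfl, hT.le⟩
  have p1 : 0 ≤ M₁ := (abs_nonneg _).trans (k1 0 h0T 0 (by norm_num))
  have p2 : 0 ≤ M₂ := (abs_nonneg _).trans (k2 0 h0T 0 (by norm_num))
  have p3 : 0 ≤ M₃ := (norm_nonneg _).trans (hM₃ 0 (by norm_num))
  -- A common bound for `ρ`, `∂_x ρ`, `ρ - h` and `E`.
  set M : ℝ := M₁ + M₂ + 2 * (M₁ + M₃) with hM
  have hM0 : 0 ≤ M := by positivity
  -- The Nernst-Planck residual dictates the constant: the two products give `7Mδ + 10δ²` and `5Mδ +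
  -- 6δ²`, the linear terms `4δ`, and `δ² ≤ δ`.
  refine ⟨12 * M + 20, fun δ hδ hδ1 => ?_⟩
  -- polynomial approximations of the density, the charge and the field
  obtain ⟨p, hp, hpρ⟩ := exists_planePoly_near hT.le (by norm_num : (-1 : ℝ) ≤ 1) hρ hδ
  obtain ⟨η, hη⟩ := exists_polynomial_near_C1 hh hδ
  -- Integrating `p - η`, rather than approximating `E`, makes the Poisson residual of the
  -- polynomials exactly `h - η`.
  obtain ⟨q, hq, p', q', hpq⟩ := exists_planePoly_antiderivative
    (planePoly.sub_mem hp (eval_mem_planePoly η))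
  simp only [Pi.sub_apply] at hpq
  -- approximation by networks
  obtain ⟨N, J, hJ, G, hG, hJp, hGN, hGJ⟩ := exists_network_jet_near hσ hpoly hp hK hδ
  obtain ⟨N', J', hJ', G', hG', hJq, hGN', hGJ'⟩ := exists_network_jet_near hσ hpoly hq hK hδ
  refine ⟨N, N', ?_⟩
  set r := N.output σ with hr
  set e := N'.output σ with he
  have J1 : ∀ t x, J (t, x) 1 = dt p t x := fun t x => by rw [dt_eq_of_mem_planeJets hJ hJp]
  have J2 : ∀ t x, J (t, x) 2 = dx p t x := fun t x => by rw [dx_eq_of_mem_planeJets hJ hJp]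
  have J4 : ∀ t x, J (t, x) 4 = dx (dx p) t x := fun t x => by
    rw [dx_dx_eq_of_mem_planeJets hJ hJp]
  have J'1 : ∀ t x, J' (t, x) 1 = q' t x := fun t x => by
    rw [← (hpq t x).2.2.1.deriv, ← (hJ' t x).1.deriv]; simp only [hJq]
  have J'2 : ∀ t x, J' (t, x) 2 = p t x - η.eval x := fun t x => by
    rw [← (hpq t x).2.1.deriv, ← (hJ' t x).2.1.deriv]; simp only [hJq]
  have hp' : ∀ t x, p' t x = dt p t x := fun t x => by
    rw [← (hpq t x).1.deriv, deriv_sub_const]; rfl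
  have J'3 : ∀ t x, J' (t, x) 3 = dt p t x := fun t x => by
    rw [← hp', ← (hpq t x).1.deriv, ← (hJ' t x).2.2.1.deriv]; simp only [J'2]
  have J'4 : ∀ t x, J' (t, x) 4 = dx p t x - η.derivative.eval x := fun t x => by
    have h1 := (hJ' t x).2.2.2
    simp only [J'2] at h1
    have h2 := (hJ t x).2.1
    simp only [hJp] at h2
    rw [← J2]
    exact h1.unique (h2.sub (η.hasDerivAt x))
  have r1 := dt_eq_of_mem_planeJets hG hGN
  have r2 := dx_eq_of_mem_planeJets hG hGN
  have r4 := dx_dx_eq_of_mem_planeJets hG hGN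
  have e1 := dt_eq_of_mem_planeJets hG' hGN'
  have e2 := dx_eq_of_mem_planeJets hG' hGN'
  -- closeness to the solution
  have near : ∀ {a b c : ℝ}, |a - b| ≤ δ → |b - c| ≤ δ → |a - c| ≤ 2 * δ := fun h1 h2 => by
    have := abs_sub_le _ _ _ |>.trans (add_le_add h1 h2)
    linarith
  have n0 : ∀ t ∈ Icc 0 T, ∀ x ∈ Icc (-1 : ℝ) 1, |r t x - ρ t x| ≤ 2 * δ := fun t ht x hx => by
    have h1 := hGJ (t, x) ⟨ht, hx⟩ 0
    rw [hGN, hJp] at h1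
    exact near h1 (hpρ t ht x hx).1
  have n1 : ∀ t ∈ Icc 0 T, ∀ x ∈ Icc (-1 : ℝ) 1, |dt r t x - dt ρ t x| ≤ 2 * δ :=
    fun t ht x hx => by
    have h1 := hGJ (t, x) ⟨ht, hx⟩ 1
    rw [J1] at h1
    rw [r1]
    exact near h1 (hpρ t ht x hx).2.1
  have n2 : ∀ t ∈ Icc 0 T, ∀ x ∈ Icc (-1 : ℝ) 1, |dx r t x - dx ρ t x| ≤ 2 * δ :=
    fun t ht x hx => by
    have h1 := hGJ (t, x) ⟨ht, hx⟩ 2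
    rw [J2] at h1
    rw [r2]
    exact near h1 (hpρ t ht x hx).2.2.1
  have n4 : ∀ t ∈ Icc 0 T, ∀ x ∈ Icc (-1 : ℝ) 1, |dx (dx r) t x - dx (dx ρ) t x| ≤ 2 * δ :=
    fun t ht x hx => by
    have h1 := hGJ (t, x) ⟨ht, hx⟩ 4
    rw [J4] at h1
    rw [r4]
    exact near h1 (hpρ t ht x hx).2.2.2
  have m0 : ∀ t ∈ Icc 0 T, ∀ x ∈ Icc (-1 : ℝ) 1, |e t x - E t x| ≤ 5 * δ := fun t ht x hx => by
    have h1 := hGJ' (t, x) ⟨ht, hx⟩ 0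
    rw [hGN', hJq] at h1
    have h2 : |q t x - E t x| ≤ 2 * (2 * δ) := by
      refine abs_le_two_mul_of_hasDerivAt (f := fun y => q t y - E t y)
        (f' := fun y => p t y - η.eval y - (ρ t y - h y)) ?_
        (fun y hy => (hpq t y).2.1.sub (hsol.poisson t ht y hy)) (fun y hy => ?_) ?_ hx
      · exact ContinuousOn.sub
          (fun y _ => (hpq t y).2.1.continuousAt.continuousWithinAt) (hsol.field_cont t ht)
      · have hy := Ioo_subset_Icc_self hy
        have h3 := (hpρ t ht y hy).1
        have h4 := (hη y hy).1
        rw [abs_le] at h3 h4 ⊢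
        constructor <;> linarith [h3.1, h3.2, h4.1, h4.2]
      · simp only [(hpq t 0).2.2.2.2.1, (hsol.dirichlet t ht).1, sub_zero]
    have := (abs_sub_le (e t x) (q t x) (E t x)).trans (add_le_add h1 h2)
    linarith
  have m2 : ∀ t ∈ Icc 0 T, ∀ x ∈ Icc (-1 : ℝ) 1, |dx e t x - (ρ t x - h x)| ≤ 3 * δ :=
    fun t ht x hx => by
    have h1 := hGJ' (t, x) ⟨ht, hx⟩ 2
    rw [J'2] at h1
    rw [e2]
    have h3 := (hpρ t ht x hx).1
    have h4 := (hη x hx).1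
    rw [abs_le] at h1 h3 h4 ⊢
    constructor <;> linarith [h1.1, h1.2, h3.1, h3.2, h4.1, h4.2]
  have hρx : ∀ t ∈ Icc 0 T, ∀ x ∈ Icc (-1 : ℝ) 1, HasDerivAt (fun y => ρ t y) (dx ρ t x) x :=
    fun t ht x hx => (hU.diff_x (t, x) (hKU ⟨ht, hx⟩)).hasDerivAt
  have hρxx : ∀ t ∈ Icc 0 T, ∀ x ∈ Icc (-1 : ℝ) 1,
      HasDerivAt (fun y => dx ρ t y) (dx (dx ρ) t x) x :=
    fun t ht x hx => (hU.diff_xx (t, x) (hKU ⟨ht, hx⟩)).hasDerivAt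
  refine lossTotal_le hT (fun t ht x hx => ?_) (fun x hx => ?_) (fun t ht x hx => ?_)
  · have ht' := Ioo_subset_Icc_self ht
    have hx' := Ioo_subset_Icc_self hx
    have hMδ : 0 ≤ M * δ := by positivity
    have eP : ∀ t x, resPoisson h r e t x = G' (t, x) 2 - G (t, x) 0 + h x := fun t x => by
      rw [resPoisson, e2, ← hGN]
    refine ⟨?_, ?_, ?_, ?_⟩
    · have hsolve : dt ρ t x = dx (dx ρ) t x - (dx ρ t x * E t x + ρ t x * (ρ t x - h x)) :=
        (hsol.nernst_planck t ht' x hx).unique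
          ((hρxx t ht' x hx').sub ((hρx t ht' x hx').mul (hsol.poisson t ht' x hx)))
      have hprod : dx (fun s y => r s y * e s y) t x = dx r t x * e t x + r t x * dx e t x := by
        have h1 := (hG t x).2.1
        have h2 := (hG' t x).2.1
        simp only [hGN, hGN'] at h1 h2
        rw [r2, e2]
        exact (h1.mul h2).deriv
      have b1 := abs_mul_sub_mul_le (n2 t ht' x hx') (m0 t ht' x hx')
        ((k2 t ht' x hx').trans (by linarith : M₂ ≤ M)) ((k4 t ht' x hx').trans (by linarith))
      have b2 := abs_mul_sub_mul_le (n0 t ht' x hx') (m2 t ht' x hx')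
        ((k1 t ht' x hx').trans (by linarith : M₁ ≤ M)) ((k3 t ht' x hx').trans (by linarith))
      have b3 := n1 t ht' x hx'
      have b4 := n4 t ht' x hx'
      have hδδ : δ * δ ≤ δ := by nlinarith
      have key : resNP r e t x = (dt r t x - dt ρ t x) - (dx (dx r) t x - dx (dx ρ) t x)
          + (dx r t x * e t x - dx ρ t x * E t x)
          + (r t x * dx e t x - ρ t x * (ρ t x - h x)) := by
        rw [resNP, hprod]; linarith
      rw [key]
      rw [abs_le] at b1 b2 b3 b4 ⊢
      constructor <;>
        linarith [b1.1, b1.2, b2.1, b2.2, b3.1, b3.2, b4.1, b4.2]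
    · have h1 := hGJ' (t, x) ⟨ht', hx'⟩ 2
      have h2 := hGJ (t, x) ⟨ht', hx'⟩ 0
      have h3 := (hη x hx').1
      rw [J'2] at h1
      rw [hJp] at h2
      rw [eP]
      rw [abs_le] at h1 h2 h3 ⊢
      constructor <;> linarith [h1.1, h1.2, h2.1, h2.2, h3.1, h3.2]
    · have hd : dt (resPoisson h r e) t x = G' (t, x) 3 - G (t, x) 1 := by
        unfold dt
        simp only [eP]
        exact (((hG' t x).2.2.1.sub (hG t x).1).add_const (h x)).deriv
      have h1 := hGJ' (t, x) ⟨ht', hx'⟩ 3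
      have h2 := hGJ (t, x) ⟨ht', hx'⟩ 1
      rw [J'3] at h1
      rw [J1] at h2
      rw [hd]
      rw [abs_le] at h1 h2 ⊢
      constructor <;> linarith [h1.1, h1.2, h2.1, h2.2]
    · have hhx : HasDerivAt h (derivWithin h (Icc (-1) 1) x) x :=
        ((hh.differentiableOn (by norm_num)) x hx').hasDerivWithinAt.hasDerivAt
          (Icc_mem_nhds hx.1 hx.2)
      have hd : dx (resPoisson h r e) t x
          = G' (t, x) 4 - G (t, x) 2 + derivWithin h (Icc (-1) 1) x := by
        unfold dx
        simp only [eP]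
        exact (((hG' t x).2.2.2.sub (hG t x).2.1).add hhx).deriv
      have h1 := hGJ' (t, x) ⟨ht', hx'⟩ 4
      have h2 := hGJ (t, x) ⟨ht', hx'⟩ 2
      have h3 := (hη x hx').2
      rw [J'4] at h1
      rw [J2] at h2
      rw [hd]
      rw [abs_le] at h1 h2 h3 ⊢
      constructor <;> linarith [h1.1, h1.2, h2.1, h2.2, h3.1, h3.2]
  · have hx' := Ioo_subset_Icc_self hx
    have hMδ : 0 ≤ M * δ := by positivity
    have hρc : ContinuousOn (ρ 0) (Icc (-1) 1) := fun y hy =>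
      (hρx 0 h0T y hy).continuousAt.continuousWithinAt
    rw [hsol.field_initial hT hh.continuousOn hρc hx, ← hsol.initial x hx]
    exact ⟨(n0 0 h0T x hx').trans (by linarith), (m0 0 h0T x hx').trans (by linarith)⟩
  · have ht' := Ioo_subset_Icc_self ht
    have hx' : x ∈ Icc (-1 : ℝ) 1 := by rcases hx with rfl | rfl <;> norm_num
    have hMδ : 0 ≤ M * δ := by positivity
    have hE : E t x = 0 := by
      rcases hx with rfl | rfl
      exacts [(hsol.dirichlet t ht').1, (hsol.dirichlet t ht').2]
    have b1 := n2 t ht' x hx'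
    have b2 := m0 t ht' x hx'
    rw [hsol.dx_density_boundary ht' hx, sub_zero] at b1
    rw [hE, sub_zero] at b2
    refine ⟨b1.trans (by linarith), b2.trans (by linarith), ?_⟩
    -- the total charge is conserved because there is no flux through the boundary
    have hflux : |q' t x - (dx ρ t x - ρ t x * E t x)| ≤ 2 * δ := by
      refine abs_le_two_mul_of_hasDerivAt (f := fun y => q' t y - (dx ρ t y - ρ t y * E t y))
        (f' := fun y => p' t y - dt ρ t y) ?_
        (fun y hy => (hpq t y).2.2.2.1.sub (hsol.nernst_planck t ht' y hy)) (fun y hy => ?_) ?_ hx'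
      · refine ContinuousOn.sub (fun y _ => (hpq t y).2.2.2.1.continuousAt.continuousWithinAt)
          (ContinuousOn.sub
            (fun y hy => (hρxx t ht' y hy).continuousAt.continuousWithinAt)
            (ContinuousOn.mul (fun y hy => (hρx t ht' y hy).continuousAt.continuousWithinAt)
              (hsol.field_cont t ht')))
      · rw [hp']
        exact (hpρ t ht' y (Ioo_subset_Icc_self hy)).2.1
      · simp only [(hpq t 0).2.2.2.2.2, (hsol.dirichlet t ht').1,
          hsol.dx_density_boundary ht' (show (-1 : ℝ) ∈ ({-1, 1} : Set ℝ) by simp)]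
        simp
    rw [hE, hsol.dx_density_boundary ht' hx, mul_zero, sub_zero, sub_zero] at hflux
    have h1 := hGJ' (t, x) ⟨ht', hx'⟩ 1
    rw [J'1] at h1
    rw [e1]
    rw [abs_le] at h1 hflux ⊢
    constructor <;> linarith [h1.1, h1.2, hflux.1, hflux.2]

end Approximation

end PNP

theorem mainTheorem4 (T : ℝ) (hT : 0 < T) (h ρ₀ : ℝ → ℝ)
    (hh : ContDiffOn ℝ 1 h (Set.Icc (-1) 1))
    (ρ E : ℝ → ℝ → ℝ)
    (hsol : PNP.IsSolution T h ρ₀ ρ E)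
    (hρ : PNP.IsHatC12 ρ (Set.Icc 0 T ×ˢ Set.Icc (-1) 1))
    (σ : ℝ → ℝ) (hσ : ContDiff ℝ 2 σ)
    (hσ_nonpoly : ¬ ∃ p : Polynomial ℝ, ∀ z : ℝ, σ z = p.eval z) :
    ∃ N M : ℕ → PNP.Network,
      Filter.Tendsto
        (fun j : ℕ => PNP.lossTotal T h ρ₀ ((N j).output σ) ((M j).output σ))
        Filter.atTop (nhds 0) := by
  obtain ⟨C, hC⟩ := PNP.exists_networks_lossTotal_le hT hh hsol hρ hσ hσ_nonpoly
  choose N M hNM using fun j : ℕ => hC (1 / ((j : ℝ) + 1)) (by positivity)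
    (by rw [div_le_one (by positivity)]; linarith [j.cast_nonneg (α := ℝ)])
  refine ⟨N, M, squeeze_zero (fun j => PNP.lossTotal_nonneg _ _ _ _ _) hNM ?_⟩
  have h1 := ((tendsto_one_div_add_atTop_nhds_zero_nat (𝕜 := ℝ)).const_mul C).pow 2
  simpa using h1.const_mul (14 * T + 4)
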